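/- Let $\pi:S^7\subset\mathbb{C}^4\to\mathbb{C}P^3$ be the Hopf fibration, $g_\circ$ the Fubini–Study metric (making $\pi$ a Riemannian submersion) and $J_\circ$ the standard complex structure. Identify $\mathbb{C}^4=\mathbb{H}^2$ by $(z_0,z_1,z_2,z_3)\mapsto(z_0+z_1j,\,z_2+z_3j)$, let $\mathcal D_1^2$ be the image under $d\pi$ of $\operatorname{span}\{jp,kp\}$, $p\in S^7$, and let $P$ be $-1$ on $\mathcal D_1^2$ and $+1$ on its $g_\circ$-orthogonal complement. The nearly Kähler structure of $\mathbb{C}P^3$ is $J=PJ_\circ$, $g(X,Y)=\tfrac32 g_\circ(X,Y)+\tfrac12 g_\circ(X,PY)$; put $G(X,Y)=(\nabla_XJ)Y$ with $\nabla$ the Levi-Civita connection of $g$. Let $M$ be a totally real surface of nearly Kähler $\mathbb{C}P^3$, i.e. a smooth 2-manifold with a smooth immersion into $\mathbb{C}P^3$ such that $g(X,JY)=0$ for all $X,Y$ tangent to $M$. Then there is an open dense subset $W$ of $M$ such that each point of $W$ has an open neighbourhood $N\subset W$ with smooth tangent fields $U,V$ on $N$ for which $$U,\;V,\;JU,\;JV,\;G(U,V),\;JG(U,V)$$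 is a $g$-orthonormal frame of $T\mathbb{C}P^3$ along $N$, $g_\circ(U,V)=0$, and $$J_\circ U=b_1V+b_2JU+b_4G(U,V)+b_5JG(U,V),\qquad J_\circ V=-b_1U+c_3JV+c_4G(U,V)+c_5JG(U,V)$$ with $b_1\ge 0$ and with coefficients of one of the following three types on all of $N$. * Type 0: there are smooth functions $\lambda,\alpha,\theta$ on $N$ with $\alpha\in\,]-\frac\pi2,\frac\pi2[$ and $(\lambda^2,\alpha)\neq(1,0)$ at every point, such that $$b_1=\tfrac{\lambda}{1+\lambda^2}(1-\sin\alpha),\quad b_2=\tfrac{\lambda^2+\sin\alpha}{1+\lambda^2},\quad b_4=\tfrac{\cos\alpha\sin\theta}{\sqrt{1+\lambda^2}},\quad b_5=\tfrac{\cos\alpha\cos\theta}{\sqrt{1+\lambda^2}},$$ $$c_3=\tfrac{1+\lambda^2\sin\alpha}{1+\lambda^2},\quad c_4=\tfrac{\lambda\cos\alpha\cos\theta}{\sqrt{1+\lambda^2}},\quad c_5=-\tfrac{\lambda\cos\alpha\sin\theta}{\sqrt{1+\lambda^2}}.$$ * Type 1: $b_1=b_2=c_3=\frac12$, $b_4=-c_5=\frac1{\sqrt2}$,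 $b_5=c_4=0$. * Type 2: there is a smooth function $\alpha$ on $N$ such that $b_1=\cos\alpha$, $b_2=\sin\alpha$, $c_3=-\sin\alpha$, $b_4=b_5=c_4=c_5=0$. Moreover, the three types do not overlap: at no point of $M$ are there two $g$-orthonormal tangent frames, equal or not, in which $J_\circ$ takes (at that point) the form of two different types. -/

import Mathlib

open scoped Manifold ContDiff LinearAlgebra.Projectivization Topology InnerProductSpace

/-- `ℂ⁴` with its Hermitian inner product; it is identified with `ℍ²` by
`(v₀, v₁, v₂, v₃) ↦ (v₀ + v₁ j, v₂ + v₃ j)`, scalars acting on the left. -/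
abbrev C4 : Type := EuclideanSpace ℂ (Fin 4)
/-- `ℂ³`, the model space of `ℂP³`. -/
abbrev C3 : Type := EuclideanSpace ℂ (Fin 3)
/-- Complex projective 3-space. -/
abbrev CP3 : Type := ℙ ℂ C4

namespace CP3

noncomputable section

/-! ### `ℂP³` as a smooth manifold -/

/-- The quotient topology. -/
instance instTopologicalSpace : TopologicalSpace CP3 :=
  inferInstanceAs (TopologicalSpace (Quotient (projectivizationSetoid ℂ C4)))

/-- `z ↦ (1, z)`. -/
def affineEmb (z : C3) : C4 := !₂[1, z 0, z 1, z 2]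

theorem affineEmb_ne_zero (z : C3) : affineEmb z ≠ 0 := fun h => by
  have := congrArg (fun v : C4 => v 0) h
  simp [affineEmb] at this

/-- The projection `ℂ⁴ ∖ 0 → ℂP³`, `v ↦ [v]`; on the unit sphere `S⁷` it is the Hopf fibration.
The value at `0` is irrelevant. -/
def hopf (v : C4) : CP3 :=
  if h : v ≠ 0 then Projectivization.mk ℂ v h
  else Projectivization.mk ℂ (affineEmb 0) (affineEmb_ne_zero 0)

theorem hopf_of_ne {v : C4} (h : v ≠ 0) : hopf v = Projectivization.mk ℂ v h := dif_pos h

theorem hopf_rep (x : CP3) : hopf x.rep = x := by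
  rw [hopf_of_ne x.rep_nonzero, Projectivization.mk_rep]

theorem hopf_smul {v : C4} {c : ℂ} (hv : v ≠ 0) (hc : c ≠ 0) : hopf (c • v) = hopf v := by
  rw [hopf_of_ne hv, hopf_of_ne (smul_ne_zero hc hv), Projectivization.mk_eq_mk_iff']
  exact ⟨c, rfl⟩

theorem exists_rep_hopf {v : C4} (hv : v ≠ 0) : ∃ c : ℂ, c ≠ 0 ∧ (hopf v).rep = c • v := by
  rw [hopf_of_ne hv]
  obtain ⟨a, ha⟩ := Projectivization.exists_smul_eq_mk_rep ℂ v hv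
  exact ⟨a, a.ne_zero, ha.symm⟩

theorem isQuotientMap_hopf :
    Topology.IsQuotientMap (fun v : {v : C4 // v ≠ 0} => hopf v) := by
  have : (fun v : {v : C4 // v ≠ 0} => hopf v) =
      (Quotient.mk (projectivizationSetoid ℂ C4)) := by
    funext v
    exact hopf_of_ne v.2
  rw [this]
  exact isQuotientMap_quotient_mk'

theorem continuousOn_hopf : ContinuousOn hopf {v | v ≠ 0} := by
  rw [continuousOn_iff_continuous_domRestrict]
  exact isQuotientMap_hopf.continuous

/-- `v ↦ (v₁/v₀, v₂/v₀, v₃/v₀)`. -/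
def ratio (v : C4) : C3 := !₂[v 1 / v 0, v 2 / v 0, v 3 / v 0]

theorem ratio_smul {c : ℂ} (hc : c ≠ 0) (v : C4) : ratio (c • v) = ratio v := by
  simp [ratio, mul_div_mul_left _ _ hc]

theorem ratio_affineEmb (z : C3) : ratio (affineEmb z) = z := by
  ext i; fin_cases i <;> simp [ratio, affineEmb]

theorem smul_affineEmb_ratio {v : C4} (hv : v 0 ≠ 0) : v 0 • affineEmb (ratio v) = v := by
  ext i; fin_cases i <;> simp [ratio, affineEmb, mul_div_cancel₀ _ hv]

theorem contDiffOn_ratio : ContDiffOn ℂ ω ratio {v | v 0 ≠ 0} := by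
  rw [contDiffOn_euclidean]
  have h : ∀ i : Fin 4, ContDiffOn ℂ ω (fun v : C4 => v i) {v | v 0 ≠ 0} := fun i =>
    (contDiff_euclidean.1 contDiff_id i).contDiffOn
  intro i
  fin_cases i
  · exact (h 1).div (h 0) fun _ hv => hv
  · exact (h 2).div (h 0) fun _ hv => hv
  · exact (h 3).div (h 0) fun _ hv => hv

theorem contDiff_affineEmb : ContDiff ℂ ω affineEmb := by
  rw [contDiff_euclidean]
  have h : ∀ i : Fin 3, ContDiff ℂ ω (fun v : C3 => v i) := fun i =>
    contDiff_euclidean.1 contDiff_id i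
  intro i
  fin_cases i
  · exact contDiff_const
  · exact h 0
  · exact h 1
  · exact h 2

/-- The affine chart of `ℂP³` attached to a linear change of coordinates `A` of `ℂ⁴`; its inverse
is `z ↦ [A (1, z)]`. -/
def affineChart (A : C4 ≃L[ℂ] C4) : OpenPartialHomeomorph CP3 C3 where
  toFun x := ratio (A.symm x.rep)
  invFun z := hopf (A (affineEmb z))
  source := {x | (A.symm x.rep) 0 ≠ 0}
  target := Set.univ
  map_source' _ _ := Set.mem_univ _
  map_target' z _ := by
    obtain ⟨c, hc, h⟩ := exists_rep_hopf (v := A (affineEmb z)) (by simpa using affineEmb_ne_zero z)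
    have h0 : affineEmb z 0 = 1 := rfl
    change (A.symm (hopf (A (affineEmb z))).rep) 0 ≠ 0
    rw [h, map_smul, A.symm_apply_apply, PiLp.smul_apply, h0]
    simpa using hc
  left_inv' x hx := by
    have hx' : (A.symm x.rep) 0 ≠ 0 := hx
    rw [← hopf_smul (by simpa using affineEmb_ne_zero _) hx', ← map_smul,
      smul_affineEmb_ratio hx', A.apply_symm_apply, hopf_rep]
  right_inv' z _ := by
    obtain ⟨c, hc, h⟩ := exists_rep_hopf (v := A (affineEmb z)) (by simpa using affineEmb_ne_zero z)
    rw [h, map_smul, ratio_smul hc, A.symm_apply_apply, ratio_affineEmb]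
  continuousOn_toFun := by
    have hs : IsOpen {x : CP3 | (A.symm x.rep) 0 ≠ 0} := by
      rw [← isQuotientMap_hopf.isOpen_preimage]
      have : (fun v : {v : C4 // v ≠ 0} => hopf v) ⁻¹' {x : CP3 | (A.symm x.rep) 0 ≠ 0} =
          {v | (A.symm v.1) 0 ≠ 0} := by
        ext v
        obtain ⟨c, hc, h⟩ := exists_rep_hopf v.2
        simp [h, hc]
      rw [this]
      exact isOpen_ne_fun (by fun_prop) continuous_const
    rw [isQuotientMap_hopf.continuousOn_isOpen_iff hs]
    have h1 : ∀ v : {v : C4 // v ≠ 0},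
        ratio (A.symm (hopf v).rep) = ratio (A.symm v.1) := fun v => by
      obtain ⟨c, hc, h⟩ := exists_rep_hopf v.2
      rw [h, map_smul, ratio_smul hc]
    have h2 : ((fun x : CP3 => ratio (A.symm x.rep)) ∘ fun v : {v : C4 // v ≠ 0} => hopf v) =
        fun v => ratio (A.symm v.1) := funext h1
    rw [h2]
    refine contDiffOn_ratio.continuousOn.comp (by fun_prop) fun v hv => ?_
    obtain ⟨c, hc, h⟩ := exists_rep_hopf v.2
    simpa [h, hc] using hv
  continuousOn_invFun := by
    refine continuousOn_hopf.comp
      (A.continuous.comp contDiff_affineEmb.continuous).continuousOn fun z _ => ?_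
    simpa using affineEmb_ne_zero z
  open_source := by
    rw [← isQuotientMap_hopf.isOpen_preimage]
    have : (fun v : {v : C4 // v ≠ 0} => hopf v) ⁻¹' {x : CP3 | (A.symm x.rep) 0 ≠ 0} =
        {v | (A.symm v.1) 0 ≠ 0} := by
      ext v
      obtain ⟨c, hc, h⟩ := exists_rep_hopf v.2
      simp [h, hc]
    rw [this]
    exact isOpen_ne_fun (by fun_prop) continuous_const
  open_target := isOpen_univ

/-- Left multiplication by the quaternion `j` on `ℍ² = ℂ⁴`. -/
def quatJ (v : C4) : C4 := !₂[-star (v 1), star (v 0), -star (v 3), star (v 2)]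

/-- Every point of `ℂP³` is `[A e₀]` for some `A ∈ Sp(2)`, that is, some unitary `A` which commutes
with `j`. -/
theorem exists_frame (x : CP3) : ∃ A : C4 ≃ₗᵢ[ℂ] C4,
    (∀ v, A (quatJ v) = quatJ (A v)) ∧ hopf (A (affineEmb 0)) = x := by
  obtain ⟨p, hp, hpx⟩ : ∃ p : C4, ‖p‖ = 1 ∧ hopf p = x := by
    have h0 : ‖x.rep‖ ≠ 0 := norm_ne_zero_iff.2 x.rep_nonzero
    refine ⟨((‖x.rep‖⁻¹ : ℝ) : ℂ) • x.rep, by simp [norm_smul, h0], ?_⟩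
    rw [hopf_smul x.rep_nonzero (by exact_mod_cast inv_ne_zero h0), hopf_rep]
  obtain ⟨q, hq, hpq, hjq⟩ : ∃ q : C4, ‖q‖ = 1 ∧ ⟪p, q⟫_ℂ = 0 ∧ ⟪quatJ p, q⟫_ℂ = 0 := by
    set S : Submodule ℂ C4 := Submodule.span ℂ (({p, quatJ p} : Finset C4) : Set C4)
    have h1 : Module.finrank ℂ S ≤ 2 := (finrank_span_finset_le_card _).trans Finset.card_le_two
    have h2 := S.finrank_add_finrank_orthogonal
    have h3 : Module.finrank ℂ C4 = 4 := by simp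
    have h4 : Sᗮ ≠ ⊥ := fun h => by
      rw [h, finrank_bot] at h2
      omega
    obtain ⟨w, hw, hw0⟩ := Submodule.exists_mem_ne_zero_of_ne_bot h4
    have hn : ‖w‖ ≠ 0 := norm_ne_zero_iff.2 hw0
    have hS : ∀ u ∈ S, ⟪u, w⟫_ℂ = 0 := (Submodule.mem_orthogonal S w).1 hw
    refine ⟨((‖w‖⁻¹ : ℝ) : ℂ) • w, by simp [norm_smul, hn], ?_, ?_⟩
    · rw [inner_smul_right, hS p (Submodule.subset_span (by simp)), mul_zero]
    · rw [inner_smul_right, hS (quatJ p) (Submodule.subset_span (by simp)), mul_zero]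
  have hj : ∀ a b : C4, ⟪quatJ a, quatJ b⟫_ℂ = ⟪b, a⟫_ℂ := fun a b => by
    simp [quatJ, PiLp.inner_apply, Fin.sum_univ_four]; ring
  have haj : ∀ a : C4, ⟪a, quatJ a⟫_ℂ = 0 := fun a => by
    simp [quatJ, PiLp.inner_apply, Fin.sum_univ_four]; ring
  have hja : ∀ a b : C4, ⟪a, quatJ b⟫_ℂ = -⟪b, quatJ a⟫_ℂ := fun a b => by
    simp [quatJ, PiLp.inner_apply, Fin.sum_univ_four]; ring
  have hqp : ⟪q, p⟫_ℂ = 0 := by rw [← inner_conj_symm, hpq, map_zero]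
  have hqjp : ⟪q, quatJ p⟫_ℂ = 0 := by rw [← inner_conj_symm, hjq, map_zero]
  have hpjq : ⟪p, quatJ q⟫_ℂ = 0 := by rw [hja, hqjp, neg_zero]
  have hflip : ∀ a b : C4, ⟪a, b⟫_ℂ = 0 → ⟪b, a⟫_ℂ = 0 := fun a b h => by
    rw [← inner_conj_symm, h, map_zero]
  have hpp : ⟪p, p⟫_ℂ = 1 := inner_self_eq_one_of_norm_eq_one hp
  have hqq : ⟪q, q⟫_ℂ = 1 := inner_self_eq_one_of_norm_eq_one hq
  have hon : Orthonormal ℂ ![p, quatJ p, q, quatJ q] := by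
    rw [orthonormal_iff_ite]
    intro i k
    fin_cases i <;> fin_cases k <;>
      simp [-inner_self_eq_norm_sq_to_K, hpp, hqq, hj, haj, hpq, hqp, hjq, hqjp, hpjq,
        hflip _ _ (haj _), hflip _ _ hpjq]
  have hcard : Fintype.card (Fin 4) = Module.finrank ℂ C4 := by simp
  let b : OrthonormalBasis (Fin 4) ℂ C4 :=
    (basisOfOrthonormalOfCardEqFinrank hon hcard).toOrthonormalBasis (by simpa using hon)
  have hb : ∀ i, b i = ![p, quatJ p, q, quatJ q] i := fun i => by simp [b]
  have hA : ∀ v : C4, b.repr.symm v =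
      v 0 • p + v 1 • quatJ p + v 2 • q + v 3 • quatJ q := fun v => by
    rw [← b.sum_repr (b.repr.symm v)]
    simp [Fin.sum_univ_four, hb]
  refine ⟨b.repr.symm, fun v => ?_, ?_⟩
  · rw [hA, hA]
    ext i; fin_cases i <;> simp [quatJ] <;> ring
  · rw [hA]; simpa [affineEmb] using hpx

/-- A choice, for every point `x`, of an element of `Sp(2)` that moves `[e₀]` to `x`. -/
def frame (x : CP3) : C4 ≃ₗᵢ[ℂ] C4 := (exists_frame x).choose

theorem hopf_frame (x : CP3) : hopf (frame x (affineEmb 0)) = x := (exists_frame x).choose_spec.2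

/-- The atlas consists of all affine charts. The preferred chart at `x` is centred at `x`. -/
instance instChartedSpace : ChartedSpace C3 CP3 where
  atlas := Set.range affineChart
  chartAt x := affineChart (frame x).toContinuousLinearEquiv
  mem_chart_source x := by
    have := (affineChart (frame x).toContinuousLinearEquiv).map_target (x := 0) (Set.mem_univ _)
    rwa [show (affineChart (frame x).toContinuousLinearEquiv).symm 0 = x from hopf_frame x] at this
  chart_mem_atlas x := Set.mem_range_self _

instance instIsManifold : IsManifold 𝓘(ℝ, C3) ∞ CP3 := by
  refine isManifold_of_contDiffOn _ _ _ ?_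
  rintro _ _ ⟨A, rfl⟩ ⟨B, rfl⟩
  have h : ContDiffOn ℂ ω (fun z : C3 => ratio (B.symm (A (affineEmb z))))
      {z | (B.symm (A (affineEmb z))) 0 ≠ 0} :=
    contDiffOn_ratio.comp ((B.symm.contDiff.comp (A.contDiff.comp contDiff_affineEmb)).contDiffOn)
      fun z hz => hz
  refine (((h.restrict_scalars ℝ).of_le le_top).congr ?_).mono ?_
  · intro z hz
    obtain ⟨c, hc, e⟩ := exists_rep_hopf (v := A (affineEmb z)) (by simpa using affineEmb_ne_zero z)
    change ratio (B.symm (hopf (A (affineEmb z))).rep) = _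
    rw [e, map_smul, ratio_smul hc]
  · rintro z ⟨⟨-, hz⟩, -⟩
    obtain ⟨c, hc, e⟩ := exists_rep_hopf (v := A (affineEmb z)) (by simpa using affineEmb_ne_zero z)
    have hz' : (B.symm (hopf (A (affineEmb z))).rep) 0 ≠ 0 := hz
    rw [e, map_smul] at hz'
    intro h0
    exact hz' (by simp [h0])

/-! ### The Kähler and the nearly Kähler structure -/

/-- The tangent space `TangentSpace 𝓘(ℝ, C3) x`, which is by definition the model space: a tangent
vector is given by its components in the preferred chart at `x`. -/
abbrev T (_x : CP3) : Type := C3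

/-- A unit vector that represents `x`; nothing below depends on the choice. -/
def unitRep (x : CP3) : C4 := frame x (affineEmb 0)

/-- The differential of the Hopf fibration at `p = unitRep x ∈ S⁷`. -/
def dHopf (x : CP3) : C4 →L[ℝ] T x := mfderiv 𝓘(ℝ, C4) 𝓘(ℝ, C3) hopf (unitRep x)

/-- The horizontal space at `p = unitRep x`: the vectors that are Hermitian orthogonal to `p`, i.e.
the tangent vectors of `S⁷` at `p` orthogonal to `i p`. -/
def horizontal (x : CP3) : Submodule ℝ C4 := (ℂ ∙ unitRep x)ᗮ.restrictScalars ℝ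

/-- The horizontal lift of tangent vectors at `x`: the inverse of the differential of the Hopf
fibration restricted to the horizontal space. -/
def hlift (x : CP3) : T x →L[ℝ] C4 :=
  (horizontal x).subtypeL ∘L ((dHopf x) ∘L (horizontal x).subtypeL).inverse

/-- The Fubini-Study metric `g_∘`, for which the Hopf fibration is a Riemannian submersion. -/
def fsMetric (x : CP3) : T x →L[ℝ] T x →L[ℝ] ℝ :=
  ContinuousLinearMap.bilinearComp (innerSL ℝ) (hlift x) (hlift x)

/-- The standard complex structure `J_∘`, induced by multiplication by `i`. -/
def J₀ (x : CP3) : T x →L[ℝ] T x :=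
  dHopf x ∘L (Complex.I • ContinuousLinearMap.id ℝ C4) ∘L hlift x

/-- The orthogonal projection of `ℂ⁴` onto `ℂ · j p = span_ℝ {j p, k p}`, for a unit vector `p`. -/
def vertProj (p : C4) : C4 →L[ℝ] C4 :=
  ((innerSL ℂ (quatJ p)).smulRight (quatJ p)).restrictScalars ℝ

/-- The almost product structure `P`: it is `-1` on `𝒟₁²`, the image of `span {j p, k p}`, and `+1` on
its orthogonal complement `𝒟₂⁴`. -/
def P (x : CP3) : T x →L[ℝ] T x :=
  dHopf x ∘L (ContinuousLinearMap.id ℝ C4 - (2 : ℝ) • vertProj (unitRep x)) ∘L hlift x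

/-- The nearly Kähler almost complex structure `J = P J_∘`. -/
def J (x : CP3) : T x →L[ℝ] T x := P x ∘L J₀ x

/-- The nearly Kähler metric `g(X, Y) = 3/2 g_∘(X, Y) + 1/2 g_∘(X, P Y)`. -/
def nkMetric (x : CP3) : T x →L[ℝ] T x →L[ℝ] ℝ :=
  (3 / 2 : ℝ) • fsMetric x + (1 / 2 : ℝ) •
    ContinuousLinearMap.bilinearComp (fsMetric x) (ContinuousLinearMap.id ℝ (T x)) (P x)

/-! ### The Levi-Civita connection in charts, and `G = ∇J` -/

/-- The differential at `y` of the inverse of the preferred chart at `x`. -/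
def dParam (x : CP3) (y : C3) : C3 →L[ℝ] T ((chartAt C3 x).symm y) :=
  mfderiv 𝓘(ℝ, C3) 𝓘(ℝ, C3) (chartAt C3 x).symm y

/-- The metric `g` read in the preferred chart at `x`. -/
def metricInChart (x : CP3) (y : C3) : C3 →L[ℝ] C3 →L[ℝ] ℝ :=
  ContinuousLinearMap.bilinearComp (nkMetric ((chartAt C3 x).symm y)) (dParam x y) (dParam x y)

/-- `J` read in the preferred chart at `x`. -/
def JInChart (x : CP3) (y : C3) : C3 →L[ℝ] C3 :=
  (dParam x y).inverse ∘L J ((chartAt C3 x).symm y) ∘L dParam x y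

/-- The Christoffel symbol `Γ_y(u, v)` of the Levi-Civita connection of `g` in the preferred chart at
`x`, given by `2 g_y(Γ_y(u, v), w) = (∂_u g)(v, w) + (∂_v g)(u, w) - (∂_w g)(u, v)`. -/
def christoffel (x : CP3) (y u v : C3) : C3 :=
  let D := fderiv ℝ (metricInChart x) y
  (metricInChart x y).inverse ((1 / 2 : ℝ) • (D u v + D v u - (D.flip u).flip v))

/-- `G(u, v) = (∇_u J) v`, where `∇` is the Levi-Civita connection of `g`, computed in the preferred
chart at `x` as `(∂_u J) v + Γ(u, J v) - J Γ(u, v)`. -/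
def G (x : CP3) (u v : T x) : T x :=
  let y : C3 := chartAt C3 x x
  fderiv ℝ (JInChart x) y u v + christoffel x y u (JInChart x y v)
    - JInChart x y (christoffel x y u v)

/-! ### Adapted frames and the three normal forms of `J_∘` -/

/-- `U`, `V` are orthonormal for `g`. -/
def IsOrthonormalPair (x : CP3) (U V : T x) : Prop :=
  nkMetric x U U = 1 ∧ nkMetric x V V = 1 ∧ nkMetric x U V = 0

/-- The six vectors `U, V, JU, JV, G(U,V), JG(U,V)`. -/
def adaptedFrame (x : CP3) (U V : T x) : Fin 6 → T x :=
  ![U, V, J x U, J x V, G x U V, J x (G x U V)]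

/-- `U, V, JU, JV, G(U,V), JG(U,V)` is a `g`-orthonormal frame of the tangent space of `ℂP³`. -/
def IsAdaptedFrame (x : CP3) (U V : T x) : Prop :=
  ∀ i k, nkMetric x (adaptedFrame x U V i) (adaptedFrame x U V k) = if i = k then 1 else 0

/-- `J_∘ U` and `J_∘ V` have the coefficients `b₁, b₂, b₄, b₅, c₃, c₄, c₅` (and `b₃ = 0`) with respect
to the frame `U, V, JU, JV, G(U,V), JG(U,V)`. -/
def HasCoefficients (x : CP3) (U V : T x) (b₁ b₂ b₄ b₅ c₃ c₄ c₅ : ℝ) : Prop :=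
  J₀ x U = b₁ • V + b₂ • J x U + b₄ • G x U V + b₅ • J x (G x U V) ∧
  J₀ x V = -b₁ • U + c₃ • J x V + c₄ • G x U V + c₅ • J x (G x U V)

/-- The normal form of Type 0 with parameters `l` (for `λ`), `α`, `θ`. The parameters
`λ = ±1, α = 0` are left out: up to a rotation and a reflection of `U, V` they give Type 1. -/
def Type0 (x : CP3) (U V : T x) (l α θ : ℝ) : Prop :=
  α ∈ Set.Ioo (-(Real.pi / 2)) (Real.pi / 2) ∧ ¬ (l ^ 2 = 1 ∧ α = 0) ∧
  HasCoefficients x U V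
    (l / (1 + l ^ 2) * (1 - Real.sin α))
    ((l ^ 2 + Real.sin α) / (1 + l ^ 2))
    (Real.cos α * Real.sin θ / √(1 + l ^ 2))
    (Real.cos α * Real.cos θ / √(1 + l ^ 2))
    ((1 + l ^ 2 * Real.sin α) / (1 + l ^ 2))
    (l * Real.cos α * Real.cos θ / √(1 + l ^ 2))
    (-(l * Real.cos α * Real.sin θ / √(1 + l ^ 2)))

/-- The normal form of Type 1. -/
def Type1 (x : CP3) (U V : T x) : Prop :=
  HasCoefficients x U V (1 / 2) (1 / 2) (1 / √2) 0 (1 / 2) 0 (-(1 / √2))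

/-- The normal form of Type 2 with parameter `α`. -/
def Type2 (x : CP3) (U V : T x) (α : ℝ) : Prop :=
  HasCoefficients x U V (Real.cos α) (Real.sin α) 0 0 (-Real.sin α) 0 0

/-! ### Totally real surfaces -/

/-- The model space `ℝ²` of surfaces. -/
abbrev E2 : Type := EuclideanSpace ℝ (Fin 2)

section Surface

variable {M : Type*} [TopologicalSpace M] [ChartedSpace E2 M] [IsManifold 𝓘(ℝ, E2) ∞ M]

/-- The differential of `f : M → ℂP³` at `q`. -/
def push (f : M → CP3) (q : M) (u : TangentSpace 𝓘(ℝ, E2) q) : T (f q) :=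
  mfderiv 𝓘(ℝ, E2) 𝓘(ℝ, C3) f q u

/-- `f : M → ℂP³` is a totally real immersed surface of the nearly Kähler `ℂP³`: a smooth immersion
such that `J` maps tangent vectors of the surface to normal vectors. -/
structure IsTotallyReal (f : M → CP3) : Prop where
  smooth : ContMDiff 𝓘(ℝ, E2) 𝓘(ℝ, C3) ∞ f
  immersion : ∀ q, Function.Injective (push f q)
  totallyReal : ∀ q u v, nkMetric (f q) (push f q u) (J (f q) (push f q v)) = 0

/-- The vector field `u` on `M` is smooth on `N`. -/
def SmoothFieldOn (N : Set M) (u : ∀ q : M, TangentSpace 𝓘(ℝ, E2) q) : Prop :=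
  ContMDiffOn 𝓘(ℝ, E2) 𝓘(ℝ, E2).tangent ∞ (fun q => (⟨q, u q⟩ : TangentBundle 𝓘(ℝ, E2) M)) N

/-- The real function `a` on `M` is smooth on `N`. -/
def SmoothFunOn (N : Set M) (a : M → ℝ) : Prop :=
  ContMDiffOn 𝓘(ℝ, E2) 𝓘(ℝ, ℝ) ∞ a N

/-- At the point `q`, some orthonormal frame of the surface puts `J_∘` into the form of Type 0. -/
def IsType0At (f : M → CP3) (q : M) : Prop :=
  ∃ u v, IsOrthonormalPair (f q) (push f q u) (push f q v) ∧
    ∃ l α θ, Type0 (f q) (push f q u) (push f q v) l α θ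

/-- At the point `q`, some orthonormal frame of the surface puts `J_∘` into the form of Type 1. -/
def IsType1At (f : M → CP3) (q : M) : Prop :=
  ∃ u v, IsOrthonormalPair (f q) (push f q u) (push f q v) ∧
    Type1 (f q) (push f q u) (push f q v)

/-- At the point `q`, some orthonormal frame of the surface puts `J_∘` into the form of Type 2. -/
def IsType2At (f : M → CP3) (q : M) : Prop :=
  ∃ u v, IsOrthonormalPair (f q) (push f q u) (push f q v) ∧
    ∃ α, Type2 (f q) (push f q u) (push f q v) α

end Surface

end
end CP3

namespace CP3

/-!
In the preferred chart centred at `x`, the tangent space at `x` is `ℂ³`, the first axis is `𝒟₁²`,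
`J_∘` is multiplication by `i`, and `J` differs from it by the sign on the first axis. There `G` is,
up to conjugations, the complex cross product; so a `g`-orthonormal pair `u`, `v` that spans a
totally real plane completes with `G(u, v)` to a unitary frame of `ℂ³`. Consequently the
coefficients of `J_∘` depend only on the first components `a`, `b`, `c` of `u`, `v`, `G(u, v)`, up
to a common phase, and `|a|² + |b|² + |c|² = 1`.

As a tangent vector runs through the unit circle, its first component traces out an ellipse. After
multiplication by a phase with square root `√(a² + b²)`, a rotation of the frame moves `a`, `b` to
the axes, as `r > 0` and `i t`. This fails to be smooth only where `a² + b²` vanishes without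
vanishing identically, and such points are avoided by shrinking the open set. That `a` and `b` do
not both vanish on an open set is the place where integrability enters: the surface would be tangent
to the contact distribution `𝒟₂⁴`, the differential of the contact form would vanish on it, hence
`c = 0`, against `|c| = 1`. The types correspond to `c = 0` (Type 2), to `t = r` and `|c|² = 1/2`
(Type 1), and to the remaining values (Type 0).

A rotation of the frame preserves `|a|² + |b|²` and `Im (ā b)²`, hence `b₂ + c₃` and `b₂ c₃`. The
sum is `0` in Type 2, `1` in Type 1 and `1 + sin α > 0` in Type 0; when `α = 0` the product takes
the Type 1 value `1/4` only if `λ² = 1`.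
-/

noncomputable section

/-! ### Coordinates -/

/-- The last three coordinates of a vector of `ℂ⁴`. -/
def tail : C4 →L[ℂ] C3 :=
  LinearMap.toContinuousLinearMap
    { toFun := fun v => !₂[v 1, v 2, v 3]
      map_add' := fun v w => by ext i; fin_cases i <;> simp
      map_smul' := fun c v => by ext i; fin_cases i <;> simp }

/-- The embedding `w ↦ (0, w)` of `ℂ³` into `ℂ⁴`, the linear part of `affineEmb`. -/
def pad : C3 →L[ℂ] C4 :=
  LinearMap.toContinuousLinearMap
    { toFun := fun w => !₂[0, w 0, w 1, w 2]
      map_add' := fun v w => by ext i; fin_cases i <;> simp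
      map_smul' := fun c v => by ext i; fin_cases i <;> simp }

@[simp] theorem tail_apply_zero (v : C4) : tail v 0 = v 1 := rfl
@[simp] theorem tail_apply_one (v : C4) : tail v 1 = v 2 := rfl
@[simp] theorem tail_apply_two (v : C4) : tail v 2 = v 3 := rfl
@[simp] theorem pad_apply_zero (v : C3) : pad v 0 = 0 := rfl
@[simp] theorem pad_apply_one (v : C3) : pad v 1 = v 0 := rfl
@[simp] theorem pad_apply_two (v : C3) : pad v 2 = v 1 := rfl
@[simp] theorem pad_apply_three (v : C3) : pad v 3 = v 2 := rfl
@[simp] theorem affineEmb_apply_zero (z : C3) : affineEmb z 0 = 1 := rfl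
@[simp] theorem affineEmb_apply_one (z : C3) : affineEmb z 1 = z 0 := rfl
@[simp] theorem affineEmb_apply_two (z : C3) : affineEmb z 2 = z 1 := rfl
@[simp] theorem affineEmb_apply_three (z : C3) : affineEmb z 3 = z 2 := rfl
@[simp] theorem quatJ_apply_zero (v : C4) : quatJ v 0 = -star (v 1) := rfl
@[simp] theorem quatJ_apply_one (v : C4) : quatJ v 1 = star (v 0) := rfl
@[simp] theorem quatJ_apply_two (v : C4) : quatJ v 2 = -star (v 3) := rfl
@[simp] theorem quatJ_apply_three (v : C4) : quatJ v 3 = star (v 2) := rfl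

@[simp] theorem tail_pad (w : C3) : tail (pad w) = w := by
  ext i; fin_cases i <;> rfl

theorem pad_tail {v : C4} (hv : v 0 = 0) : pad (tail v) = v := by
  ext i; fin_cases i <;> simp [hv]

theorem affineEmb_eq_add_pad (z : C3) : affineEmb z = affineEmb 0 + pad z := by
  ext i; fin_cases i <;> simp

theorem quatJ_smul (c : ℂ) (v : C4) : quatJ (c • v) = star c • quatJ v := by
  ext i; fin_cases i <;> simp

theorem inner_C3 (v w : C3) :
    ⟪v, w⟫_ℂ = star (v 0) * w 0 + star (v 1) * w 1 + star (v 2) * w 2 := by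
  simp only [PiLp.inner_apply, RCLike.inner_apply', Fin.sum_univ_three, starRingEnd_apply]

theorem inner_C4 (v w : C4) : ⟪v, w⟫_ℂ =
    star (v 0) * w 0 + star (v 1) * w 1 + star (v 2) * w 2 + star (v 3) * w 3 := by
  simp only [PiLp.inner_apply, RCLike.inner_apply', Fin.sum_univ_four, starRingEnd_apply]

theorem real_inner_C4 (v w : C4) : inner ℝ v w = (⟪v, w⟫_ℂ).re := by
  simp [PiLp.inner_apply, Fin.sum_univ_four, Complex.inner]

theorem inner_pad_pad (v w : C3) : ⟪pad v, pad w⟫_ℂ = ⟪v, w⟫_ℂ := by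
  simp [inner_C4, inner_C3]

theorem inner_affineEmb_zero_left (v : C4) : ⟪affineEmb 0, v⟫_ℂ = v 0 := by
  simp [inner_C4]

theorem inner_affineEmb_self (y : C3) :
    ⟪affineEmb y, affineEmb y⟫_ℂ = ((1 + ‖y‖ ^ 2 : ℝ) : ℂ) := by
  have h : ⟪y, y⟫_ℂ = ((‖y‖ ^ 2 : ℝ) : ℂ) := by
    rw [inner_self_eq_norm_sq_to_K, Complex.ofReal_pow]; rfl
  rw [Complex.ofReal_add, ← h, inner_C4, inner_C3]
  simp
  ring

theorem hasFDerivAt_affineEmb (y : C3) : HasFDerivAt affineEmb (pad.restrictScalars ℝ) y := by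
  rw [show affineEmb = fun z => affineEmb 0 + pad z from funext affineEmb_eq_add_pad]
  exact (pad.restrictScalars ℝ).hasFDerivAt.const_add _

theorem hasFDerivAt_ratio {c : ℂ} (hc : c ≠ 0) :
    HasFDerivAt ratio ((c⁻¹ • tail).restrictScalars ℝ) (c • affineEmb 0) := by
  have coord : ∀ i : Fin 4, HasFDerivAt (𝕜 := ℂ) (fun v : C4 => v i)
      (EuclideanSpace.proj i : C4 →L[ℂ] ℂ) (c • affineEmb 0) := fun i =>
    (EuclideanSpace.proj i : C4 →L[ℂ] ℂ).hasFDerivAt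
  have eval : ∀ i : Fin 4, (affineEmb 0) i = if i = 0 then 1 else 0 := fun i => by
    fin_cases i <;> simp
  have quotient : ∀ i : Fin 4, i ≠ 0 → HasFDerivAt (𝕜 := ℂ) (fun v : C4 => v i / v 0)
      (c⁻¹ • (EuclideanSpace.proj i : C4 →L[ℂ] ℂ)) (c • affineEmb 0) := fun i hi => by
    have h0 : (c • affineEmb 0 : C4) 0 ≠ 0 := by simpa using hc
    refine ((coord i).mul
      ((hasDerivAt_inv h0).comp_hasFDerivAt (c • affineEmb 0 : C4) (coord 0))).congr_fderiv ?_
    ext v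
    simp [eval, hi]
  refine HasFDerivAt.restrictScalars ℝ (hasFDerivWithinAt_univ.1
    (hasFDerivWithinAt_euclidean.2 fun i => ?_))
  rw [hasFDerivWithinAt_univ]
  fin_cases i
  · exact quotient 1 (by decide)
  · exact quotient 2 (by decide)
  · exact quotient 3 (by decide)

/-! ### The Kähler and nearly Kähler structures in the preferred chart -/

theorem frame_quatJ (x : CP3) (v : C4) : frame x (quatJ v) = quatJ (frame x v) :=
  (exists_frame x).choose_spec.1 v

theorem frame_symm_quatJ (x : CP3) (v : C4) :
    (frame x).symm (quatJ v) = quatJ ((frame x).symm v) := by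
  rw [LinearIsometryEquiv.symm_apply_eq, frame_quatJ, LinearIsometryEquiv.apply_symm_apply]

theorem chartAt_hopf (x : CP3) {v : C4} (hv : v ≠ 0) :
    chartAt C3 x (hopf v) = ratio ((frame x).symm v) := by
  obtain ⟨c, hc, h⟩ := exists_rep_hopf hv
  change ratio ((frame x).symm (hopf v).rep) = _
  rw [h, map_smul, ratio_smul hc]

theorem frame_affineEmb_ne_zero (x : CP3) (y : C3) : frame x (affineEmb y) ≠ 0 :=
  (map_ne_zero_iff _ (frame x).injective).2 (affineEmb_ne_zero y)

theorem chartAt_self (x : CP3) : chartAt C3 x x = 0 := by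
  nth_rw 2 [← hopf_frame x]
  rw [chartAt_hopf x (frame_affineEmb_ne_zero x 0), LinearIsometryEquiv.symm_apply_apply,
    ratio_affineEmb]

theorem hasMFDerivAt_of_chart {E : Type*} [NormedAddCommGroup E] [NormedSpace ℝ E] {h : E → CP3}
    {p : E} {L : E →L[ℝ] C3} (hc : ContinuousAt h p)
    (hd : HasFDerivAt (fun v => (chartAt C3 (h p) (h v) : C3)) L p) :
    HasMFDerivAt 𝓘(ℝ, E) 𝓘(ℝ, C3) h p L :=
  ⟨hc, hd.hasFDerivWithinAt⟩

theorem hasMFDerivAt_hopf {v : C4} (hv : v ≠ 0) {c : ℂ} (hc : c ≠ 0)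
    (h : (frame (hopf v)).symm v = c • affineEmb 0) :
    HasMFDerivAt 𝓘(ℝ, C4) 𝓘(ℝ, C3) hopf v
      ((c⁻¹ • tail).restrictScalars ℝ ∘L
        ((frame (hopf v)).symm.toContinuousLinearEquiv.restrictScalars ℝ : C4 →L[ℝ] C4)) := by
  have nonzero : ∀ᶠ w in 𝓝 v, w ≠ 0 := isOpen_ne.mem_nhds hv
  refine hasMFDerivAt_of_chart (continuousOn_hopf.continuousAt nonzero)
    (HasFDerivAt.congr_of_eventuallyEq ?_ (nonzero.mono fun w hw => chartAt_hopf (hopf v) hw))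
  exact HasFDerivAt.comp v (g := ratio) (h ▸ hasFDerivAt_ratio hc)
    ((frame (hopf v)).symm.toContinuousLinearEquiv.restrictScalars ℝ : C4 →L[ℝ] C4).hasFDerivAt

theorem dHopf_apply (x : CP3) (v : C4) : dHopf x v = tail ((frame x).symm v) := by
  have normalized : (frame (hopf (unitRep x))).symm (unitRep x) = (1 : ℂ) • affineEmb 0 := by
    rw [unitRep, hopf_frame, LinearIsometryEquiv.symm_apply_apply, one_smul]
  have h := (hasMFDerivAt_hopf (frame_affineEmb_ne_zero x 0) one_ne_zero normalized).mfderiv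
  rw [dHopf, unitRep, h, hopf_frame, inv_one, one_smul]
  rfl

theorem mem_horizontal_iff (x : CP3) (v : C4) : v ∈ horizontal x ↔ (frame x).symm v 0 = 0 := by
  rw [horizontal, Submodule.restrictScalars_mem,
    Submodule.mem_orthogonal_singleton_iff_inner_right, unitRep, ← (frame x).symm.inner_map_map,
    LinearIsometryEquiv.symm_apply_apply, inner_affineEmb_zero_left]

theorem hlift_apply (x : CP3) (w : T x) : hlift x w = frame x (pad w) := by
  let lift : C3 →L[ℝ] horizontal x := ContinuousLinearMap.codRestrict
    (((frame x).toContinuousLinearEquiv.restrictScalars ℝ : C4 →L[ℝ] C4) ∘L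
      pad.restrictScalars ℝ) (horizontal x) fun w => by simp [mem_horizontal_iff]
  have lift_apply : ∀ w, (lift w : C4) = frame x (pad w) := fun w => rfl
  have inverse_eq : (dHopf x ∘L (horizontal x).subtypeL).inverse = lift := by
    apply ContinuousLinearMap.inverse_eq
    · ext1 w
      change dHopf x (lift w) = w
      rw [dHopf_apply, lift_apply, LinearIsometryEquiv.symm_apply_apply, tail_pad]
    · ext1 v
      apply Subtype.ext
      change (lift (dHopf x v) : C4) = v
      rw [lift_apply, dHopf_apply, pad_tail ((mem_horizontal_iff x v).1 v.2),
        LinearIsometryEquiv.apply_symm_apply]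
  rw [hlift, inverse_eq]
  exact lift_apply w

theorem J₀_apply (x : CP3) (w : T x) : J₀ x w = Complex.I • w := by
  change dHopf x (Complex.I • hlift x w) = _
  rw [dHopf_apply, hlift_apply, map_smul, map_smul, LinearIsometryEquiv.symm_apply_apply,
    tail_pad]

theorem fsMetric_apply (x : CP3) (u v : T x) : fsMetric x u v = (⟪(u : C3), v⟫_ℂ).re := by
  change inner ℝ (hlift x u) (hlift x v) = _
  rw [hlift_apply, hlift_apply, real_inner_C4, LinearIsometryEquiv.inner_map_map, inner_pad_pad]

theorem P_apply (x : CP3) (w : T x) : P x w = !₂[-w 0, w 1, w 2] := by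
  change dHopf x (hlift x w - (2 : ℝ) • vertProj (unitRep x) (hlift x w)) = _
  have vertical : vertProj (unitRep x) (hlift x w) = frame x (w 0 • quatJ (affineEmb 0)) := by
    change ⟪quatJ (unitRep x), hlift x w⟫_ℂ • quatJ (unitRep x) = _
    rw [hlift_apply, unitRep, ← frame_quatJ, LinearIsometryEquiv.inner_map_map, map_smul]
    simp [inner_C4]
  rw [vertical, dHopf_apply, hlift_apply, map_sub, LinearIsometryEquiv.symm_apply_apply,
    ← Complex.coe_smul, map_smul, LinearIsometryEquiv.symm_apply_apply]
  ext i
  fin_cases i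
  · simp
    ring
  all_goals simp

theorem J_apply (x : CP3) (w : T x) :
    J x w = !₂[-(Complex.I * w 0), Complex.I * w 1, Complex.I * w 2] := by
  change P x (J₀ x w) = _
  rw [P_apply, J₀_apply]
  rfl

theorem nkMetric_apply (x : CP3) (u v : T x) :
    nkMetric x u v = (2 * ⟪(u : C3), v⟫_ℂ - star (u 0) * v 0).re := by
  change (3 / 2 : ℝ) * fsMetric x u v + (1 / 2 : ℝ) * fsMetric x u (P x v) = _
  rw [P_apply, fsMetric_apply, fsMetric_apply, inner_C3, inner_C3]
  simp
  ring

/-! ### Transitions between preferred charts -/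

/-- The element of `Sp(2)` that passes from the affine coordinates of the preferred chart at `x` to
those of the preferred chart at the point with coordinate `y`. -/
def transition (x : CP3) (y : C3) : C4 ≃ₗᵢ[ℂ] C4 :=
  (frame x).trans (frame ((chartAt C3 x).symm y)).symm

/-- The scalar `c` such that `transition x y` maps `(1, y)` to `c e₀`. -/
def transitionFactor (x : CP3) (y : C3) : ℂ := transition x y (affineEmb y) 0

/-- The holomorphic contact form `dy₀ - y₂ dy₁ + y₁ dy₂`, whose kernel is `𝒟₂⁴`. -/
def contact (y v : C3) : ℂ := v 0 - y 2 * v 1 + y 1 * v 2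

/-- The symplectic form on the contact distribution at the origin of the preferred chart; up to a
factor it is the differential of `contact`. -/
def area (v w : C3) : ℂ := v 1 * w 2 - v 2 * w 1

theorem contact_eq_inner (y v : C3) : contact y v = ⟪quatJ (affineEmb y), pad v⟫_ℂ := by
  simp [inner_C4, contact]
  ring

theorem inner_quatJ_pad (v w : C4) :
    ⟪quatJ v, w⟫_ℂ = v 0 * w 1 - v 1 * w 0 + area (tail v) (tail w) := by
  simp [inner_C4, area]
  ring

section Transition

variable (x : CP3) (y : C3)

theorem transition_quatJ (v : C4) :
    transition x y (quatJ v) = quatJ (transition x y v) := by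
  simp only [transition, LinearIsometryEquiv.trans_apply, frame_quatJ, frame_symm_quatJ]

theorem inner_quatJ_transition (v w : C4) :
    ⟪quatJ (transition x y v), transition x y w⟫_ℂ = ⟪quatJ v, w⟫_ℂ := by
  rw [← transition_quatJ, LinearIsometryEquiv.inner_map_map]

theorem transition_affineEmb :
    transition x y (affineEmb y) = transitionFactor x y • affineEmb 0 := by
  set x' := (chartAt C3 x).symm y
  have same_point : hopf (frame x' (affineEmb 0)) = hopf (frame x (affineEmb y)) := by
    rw [hopf_frame]; rfl
  obtain ⟨c, hc⟩ : ∃ c : ℂ, c • frame x' (affineEmb 0) = frame x (affineEmb y) := by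
    rwa [hopf_of_ne (frame_affineEmb_ne_zero x' 0), hopf_of_ne (frame_affineEmb_ne_zero x y),
      eq_comm, Projectivization.mk_eq_mk_iff'] at same_point
  have h : transition x y (affineEmb y) = c • affineEmb 0 := by
    rw [transition, LinearIsometryEquiv.trans_apply, ← hc, map_smul,
      LinearIsometryEquiv.symm_apply_apply]
  rw [transitionFactor, h]
  simp

theorem transitionFactor_mul_star :
    transitionFactor x y * star (transitionFactor x y) = ((1 + ‖y‖ ^ 2 : ℝ) : ℂ) := by
  rw [← inner_affineEmb_self, ← (transition x y).inner_map_map, transition_affineEmb,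
    inner_smul_left, inner_smul_right, inner_affineEmb_zero_left]
  simp [mul_comm]

theorem transitionFactor_ne_zero : transitionFactor x y ≠ 0 := fun h => by
  have h' := transitionFactor_mul_star x y
  rw [h, zero_mul, eq_comm, Complex.ofReal_eq_zero] at h'
  exact (by positivity : (1 + ‖y‖ ^ 2) ≠ 0) h'

theorem hasMFDerivAt_chartAt_symm :
    HasMFDerivAt 𝓘(ℝ, C3) 𝓘(ℝ, C3) (chartAt C3 x).symm y
      ((((transitionFactor x y)⁻¹ • tail).restrictScalars ℝ) ∘L
        ((transition x y).toContinuousLinearEquiv.restrictScalars ℝ : C4 →L[ℝ] C4) ∘L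
          pad.restrictScalars ℝ) := by
  have outer := hasMFDerivAt_hopf (frame_affineEmb_ne_zero x y) (transitionFactor_ne_zero x y)
    (transition_affineEmb x y)
  have inner : HasFDerivAt (fun z => frame x (affineEmb z)) _ y :=
    ((frame x).toContinuousLinearEquiv.restrictScalars ℝ : C4 →L[ℝ] C4).hasFDerivAt.comp y
      (hasFDerivAt_affineEmb y)
  exact (outer.comp y inner.hasMFDerivAt :)

theorem hasMFDerivAt_dParam :
    HasMFDerivAt 𝓘(ℝ, C3) 𝓘(ℝ, C3) (chartAt C3 x).symm y (dParam x y) :=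
  (hasMFDerivAt_chartAt_symm x y).mdifferentiableAt.hasMFDerivAt

theorem dParam_apply (v : C3) :
    dParam x y v = (transitionFactor x y)⁻¹ • tail (transition x y (pad v)) := by
  rw [dParam, (hasMFDerivAt_chartAt_symm x y).mfderiv]
  rfl

theorem transition_pad_apply_zero (v : C3) :
    transition x y (pad v) 0 = ⟪y, v⟫_ℂ / star (transitionFactor x y) := by
  have h := (transition x y).inner_map_map (affineEmb y) (pad v)
  rw [transition_affineEmb, inner_smul_left, inner_affineEmb_zero_left] at h
  rw [eq_div_iff (star_ne_zero.2 (transitionFactor_ne_zero x y)), mul_comm]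
  refine h.trans ?_
  simp [inner_C4, inner_C3]

theorem transition_pad_apply_one (v : C3) :
    transition x y (pad v) 1 = contact y v / transitionFactor x y := by
  rw [contact_eq_inner, ← inner_quatJ_transition x, transition_affineEmb, quatJ_smul,
    eq_div_iff (transitionFactor_ne_zero x y), inner_smul_left, mul_comm]
  simp [inner_C4]

theorem dParam_apply_zero (v : C3) :
    dParam x y v 0 = contact y v / transitionFactor x y ^ 2 := by
  rw [dParam_apply, PiLp.smul_apply, smul_eq_mul, tail_apply_zero, transition_pad_apply_one,
    sq, ← div_div, inv_mul_eq_div]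

theorem area_dParam (v w : C3) :
    area (dParam x y v) (dParam x y w) =
      (area v w - (⟪y, v⟫_ℂ * contact y w - contact y v * ⟪y, w⟫_ℂ) / ((1 + ‖y‖ ^ 2 : ℝ) : ℂ)) /
        transitionFactor x y ^ 2 := by
  have hc := transitionFactor_ne_zero x y
  have hc' : star (transitionFactor x y) ≠ 0 := star_ne_zero.2 hc
  have h := inner_quatJ_transition x y (pad v) (pad w)
  simp only [inner_quatJ_pad, transition_pad_apply_zero, transition_pad_apply_one,
    pad_apply_zero, tail_pad] at h
  have area_smul : ∀ (a : ℂ) (v w : C3), area (a • v) (a • w) = a ^ 2 * area v w := fun a v w => by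
    simp only [area, PiLp.smul_apply, smul_eq_mul]; ring
  rw [dParam_apply, dParam_apply, area_smul, ← transitionFactor_mul_star x y]
  field_simp
  field_simp at h
  linear_combination h

theorem inner_dParam (v w : C3) :
    ⟪(dParam x y v : C3), dParam x y w⟫_ℂ =
      ⟪v, w⟫_ℂ / ((1 + ‖y‖ ^ 2 : ℝ) : ℂ) -
        star ⟪y, v⟫_ℂ * ⟪y, w⟫_ℂ / ((1 + ‖y‖ ^ 2 : ℝ) : ℂ) ^ 2 := by
  have hc := transitionFactor_ne_zero x y
  have hc' : (starRingEnd ℂ) (transitionFactor x y) ≠ 0 := star_ne_zero.2 hc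
  have inner_eq_tail : ∀ a b : C4, ⟪a, b⟫_ℂ = star (a 0) * b 0 + ⟪tail a, tail b⟫_ℂ :=
    fun a b => by rw [inner_C4, inner_C3]; simp; ring
  have h := (transition x y).inner_map_map (pad v) (pad w)
  rw [inner_eq_tail, inner_pad_pad, transition_pad_apply_zero, transition_pad_apply_zero,
    ← eq_sub_iff_add_eq'] at h
  rw [dParam_apply, dParam_apply, inner_smul_left, inner_smul_right, h,
    ← transitionFactor_mul_star x y]
  simp only [map_inv₀, star_div₀, RCLike.star_def, Complex.conj_conj]
  field_simp

theorem dParam_smul (a : ℂ) (v : C3) :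
    dParam x y (a • v) = a • (dParam x y v : C3) := by
  rw [dParam_apply, dParam_apply, map_smul, map_smul, map_smul, smul_comm]

theorem dParam_injective : Function.Injective (dParam x y) := by
  refine (injective_iff_map_eq_zero _).2 fun v hv => ?_
  have tail_eq_zero : tail (transition x y (pad v)) = 0 := by
    simpa [dParam_apply, transitionFactor_ne_zero] using hv
  obtain ⟨s, hs⟩ : ∃ s : ℂ, transition x y (pad v) = transition x y (s • affineEmb y) := by
    refine ⟨transition x y (pad v) 0 / transitionFactor x y, ?_⟩
    rw [map_smul, transition_affineEmb, smul_smul, div_mul_cancel₀ _ (transitionFactor_ne_zero x y)]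
    ext i
    fin_cases i
    · simp
    · simpa using congrArg (fun w : C3 => w 0) tail_eq_zero
    · simpa using congrArg (fun w : C3 => w 1) tail_eq_zero
    · simpa using congrArg (fun w : C3 => w 2) tail_eq_zero
  have pad_eq := (transition x y).injective hs
  have s_eq_zero : s = 0 := by simpa using (congrArg (fun w : C4 => w 0) pad_eq).symm
  rw [← tail_pad v, pad_eq, s_eq_zero, zero_smul, map_zero]

theorem dParam_isInvertible : (dParam x y).IsInvertible :=
  ⟨(LinearEquiv.ofInjectiveEndo (dParam x y : C3 →ₗ[ℝ] C3)
    (dParam_injective x y)).toContinuousLinearEquiv, rfl⟩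

/-- The component of `j (1, y)` in the chart: it spans `𝒟₁²`. -/
def quatDir (y : C3) : C3 := tail (quatJ (affineEmb y) + star (y 0) • affineEmb y)

theorem pad_quatDir : pad (quatDir y) = quatJ (affineEmb y) + star (y 0) • affineEmb y :=
  pad_tail (by simp)

theorem transition_pad_quatDir : transition x y (pad (quatDir y)) =
    star (transitionFactor x y) • quatJ (affineEmb 0) +
      (star (y 0) * transitionFactor x y) • affineEmb 0 := by
  rw [pad_quatDir, map_add, map_smul, transition_quatJ, transition_affineEmb, quatJ_smul, smul_smul]

theorem dParam_quatDir (v : C3) :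
    dParam x y ((contact y v / ((1 + ‖y‖ ^ 2 : ℝ) : ℂ)) • quatDir y) =
      (!₂[dParam x y v 0, 0, 0] : C3) := by
  have hc := transitionFactor_ne_zero x y
  have hc' : (starRingEnd ℂ) (transitionFactor x y) ≠ 0 := star_ne_zero.2 hc
  rw [dParam_smul, dParam_apply_zero, dParam_apply, transition_pad_quatDir,
    ← transitionFactor_mul_star x y]
  ext i
  fin_cases i
  · simp
    field_simp
  all_goals simp

end Transition

/-! ### The metric and `J` near the centre of a chart -/

theorem metricInChart_apply (x : CP3) (y u v : C3) :
    metricInChart x y u v = (2 * ⟪u, v⟫_ℂ / ((1 + ‖y‖ ^ 2 : ℝ) : ℂ) -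
      (2 * (star ⟪y, u⟫_ℂ * ⟪y, v⟫_ℂ) + star (contact y u) * contact y v) /
        ((1 + ‖y‖ ^ 2 : ℝ) : ℂ) ^ 2).re := by
  have hc := transitionFactor_ne_zero x y
  have hc' : star (transitionFactor x y) ≠ 0 := star_ne_zero.2 hc
  change nkMetric _ (dParam x y u) (dParam x y v) = _
  rw [nkMetric_apply, inner_dParam, dParam_apply_zero, dParam_apply_zero,
    ← transitionFactor_mul_star x y, star_div₀, star_pow]
  congr 1
  field_simp
  ring

theorem JInChart_apply (x : CP3) (y v : C3) :
    JInChart x y v = Complex.I • v -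
      (2 * Complex.I * contact y v / ((1 + ‖y‖ ^ 2 : ℝ) : ℂ)) • quatDir y := by
  rw [mul_div_assoc, mul_smul]
  change (dParam x y).inverse (J _ (dParam x y v)) = _
  rw [← (dParam_isInvertible x y).inverse_apply_self (Complex.I • v - _)]
  congr 1
  rw [map_sub, dParam_smul, dParam_smul, dParam_quatDir, J_apply]
  ext i
  fin_cases i
  · simp
    ring
  all_goals simp

theorem contDiff_contact (u : C3) : ContDiff ℝ ∞ fun y => contact y u := by
  unfold contact
  fun_prop

theorem contDiff_quatDir : ContDiff ℝ ∞ quatDir := by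
  have conj : ContDiff ℝ ∞ (starRingEnd ℂ) := Complex.conjCLE.contDiff
  have coord : ∀ i : Fin 3, ContDiff ℝ ∞ fun y : C3 => y i := fun i =>
    (contDiff_piLp 2).1 contDiff_id i
  have conj_coord : ∀ i : Fin 3, ContDiff ℝ ∞ fun y : C3 => starRingEnd ℂ (y i) := fun i =>
    conj.comp (coord i)
  refine (contDiff_piLp 2).2 fun i => ?_
  fin_cases i
  · exact (conj.comp contDiff_const).add ((conj_coord 0).mul (coord 0))
  · exact (conj_coord 2).neg.add ((conj_coord 0).mul (coord 1))
  · exact (conj_coord 1).add ((conj_coord 0).mul (coord 2))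

theorem contDiff_inv_one_add_norm_sq :
    ContDiff ℝ ∞ fun y : C3 => ((1 + ‖y‖ ^ 2 : ℝ) : ℂ)⁻¹ :=
  ContDiff.inv (Complex.ofRealCLM.contDiff.comp (contDiff_const.add (contDiff_id.norm_sq ℝ)))
    fun y => Complex.ofReal_ne_zero.2 (by positivity)

theorem contDiff_metricInChart (x : CP3) : ContDiff ℝ ∞ (metricInChart x) := by
  have conj : ContDiff ℝ ∞ (star : ℂ → ℂ) := Complex.conjCLE.contDiff
  have inner : ∀ w : C3, ContDiff ℝ ∞ fun y : C3 => ⟪y, w⟫_ℂ := fun w =>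
    contDiff_id.inner ℂ contDiff_const
  simp only [contDiff_clm_apply_iff, metricInChart_apply, div_eq_mul_inv, ← inv_pow]
  refine fun u v => Complex.reCLM.contDiff.comp ((contDiff_const.mul
    contDiff_inv_one_add_norm_sq).sub (.mul (.add ?_ ?_) (contDiff_inv_one_add_norm_sq.pow 2)))
  · exact contDiff_const.mul ((conj.comp (inner u)).mul (inner v))
  · exact (conj.comp (contDiff_contact u)).mul (contDiff_contact v)

theorem contDiff_JInChart (x : CP3) : ContDiff ℝ ∞ (JInChart x) := by
  simp only [contDiff_clm_apply_iff, JInChart_apply, div_eq_mul_inv]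
  exact fun v => contDiff_const.sub (((contDiff_const.mul (contDiff_contact v)).mul
    contDiff_inv_one_add_norm_sq).fun_smul contDiff_quatDir)

theorem fderiv_apply_eq_of_line {E F : Type*} [NormedAddCommGroup E] [NormedSpace ℝ E]
    [NormedAddCommGroup F] [NormedSpace ℝ F] {f : E → F} {f' : F} {h : E}
    (hf : DifferentiableAt ℝ f 0) (hd : HasDerivAt (fun t : ℝ => f (t • h)) f' 0) :
    fderiv ℝ f 0 h = f' := by
  have line : HasDerivAt (fun t : ℝ => t • h) h 0 := by
    simpa using (hasDerivAt_id (0 : ℝ)).smul_const h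
  have outer : HasFDerivAt f (fderiv ℝ f 0) ((0 : ℝ) • h) := by
    rw [zero_smul]; exact hf.hasFDerivAt
  exact (outer.comp_hasDerivAt 0 line).unique hd

theorem contact_line (t : ℝ) (h u : C3) : contact (t • h) u = u 0 + t * area h u := by
  simp [contact, area]
  ring

theorem quatDir_line (t : ℝ) (h : C3) : quatDir (t • h) =
    !₂[1, 0, 0] + (t : ℂ) • !₂[0, -star (h 2), star (h 1)] +
      (t : ℂ) ^ 2 • (star (h 0) • h) := by
  ext i
  fin_cases i <;> (simp [quatDir]; ring)

theorem inner_line (t : ℝ) (h u : C3) : ⟪t • h, u⟫_ℂ = t * ⟪h, u⟫_ℂ := by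
  rw [← Complex.coe_smul, inner_smul_left, Complex.conj_ofReal]

theorem one_add_norm_sq_line (t : ℝ) (h : C3) :
    ((1 + ‖t • h‖ ^ 2 : ℝ) : ℂ) = 1 + (t : ℂ) ^ 2 * ‖h‖ ^ 2 := by
  rw [norm_smul, mul_pow, Real.norm_eq_abs, sq_abs]
  push_cast
  rfl

theorem hasDerivAt_inv_one_add_sq_mul (k : ℂ) :
    HasDerivAt (fun t : ℝ => (1 + (t : ℂ) ^ 2 * k)⁻¹) 0 0 := by
  have h : HasDerivAt (fun t : ℝ => 1 + (t : ℂ) ^ 2 * k) 0 0 := by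
    simpa using (((hasDerivAt_id (0 : ℝ)).ofReal_comp.pow 2).mul_const k).const_add 1
  simpa using h.fun_inv (by simp)

theorem hasDerivAt_metricInChart_line (x : CP3) (h u v : C3) :
    HasDerivAt (fun t : ℝ => metricInChart x (t • h) u v)
      (-(star (u 0) * area h v + star (area h u) * v 0)).re 0 := by
  have inverse := hasDerivAt_inv_one_add_sq_mul (‖h‖ ^ 2 : ℝ)
  have param : HasDerivAt (fun t : ℝ => (t : ℂ)) 1 0 := (hasDerivAt_id (0 : ℝ)).ofReal_comp
  have radial := (param.mul param).mul_const (2 * (star ⟪h, u⟫_ℂ * ⟪h, v⟫_ℂ))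
  have contact_u := (param.mul_const (star (area h u))).const_add (star (u 0))
  have contact_v := (param.mul_const (area h v)).const_add (v 0)
  have total := (inverse.const_mul (2 * ⟪u, v⟫_ℂ)).sub
    ((radial.add (contact_u.mul contact_v)).mul (inverse.mul inverse))
  refine ((Complex.reCLM.hasFDerivAt.comp_hasDerivAt 0 total).congr_deriv ?_).congr_of_eventuallyEq
    (Filter.Eventually.of_forall fun t => ?_)
  · simp
    ring
  · simp only [metricInChart_apply, contact_line, inner_line, one_add_norm_sq_line,
      Function.comp_apply, Complex.reCLM_apply, Complex.ofReal_pow, div_eq_mul_inv, ← inv_pow,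
      star_add, star_mul', Complex.star_def, Complex.conj_ofReal, Pi.sub_apply, Pi.mul_apply,
      Pi.add_apply]
    congr 1
    ring

theorem fderiv_metricInChart (x : CP3) (h u v : C3) :
    fderiv ℝ (metricInChart x) 0 h u v =
      (-(star (u 0) * area h v + star (area h u) * v 0)).re := by
  have smooth : Differentiable ℝ (metricInChart x) :=
    (contDiff_metricInChart x).differentiable (by simp)
  have smooth_apply : Differentiable ℝ fun y => metricInChart x y u :=
    smooth.clm_apply (differentiable_const u)
  rw [← fderiv_apply_eq_of_line (smooth_apply.clm_apply (differentiable_const v) 0)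
      (hasDerivAt_metricInChart_line x h u v),
    fderiv_clm_apply (smooth_apply 0) (differentiableAt_const v),
    fderiv_clm_apply (smooth 0) (differentiableAt_const u)]
  simp

theorem hasDerivAt_JInChart_line (x : CP3) (h v : C3) :
    HasDerivAt (fun t : ℝ => JInChart x (t • h) v)
      (-(2 * Complex.I) • !₂[area h v, -(v 0 * star (h 2)), v 0 * star (h 1)] : C3) 0 := by
  have inverse := hasDerivAt_inv_one_add_sq_mul (‖h‖ ^ 2 : ℝ)
  have param : HasDerivAt (fun t : ℝ => (t : ℂ)) 1 0 := (hasDerivAt_id (0 : ℝ)).ofReal_comp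
  have contact_v := (param.mul_const (area h v)).const_add (v 0)
  have direction := ((param.smul_const (!₂[0, -star (h 2), star (h 1)] : C3)).const_add
    (!₂[1, 0, 0] : C3)).add ((param.pow 2).smul_const (star (h 0) • h))
  have total := (((contact_v.const_mul (2 * Complex.I)).mul inverse).smul direction).const_sub
    (Complex.I • v)
  refine (total.congr_deriv ?_).congr_of_eventuallyEq (Filter.Eventually.of_forall fun t => ?_)
  · ext i
    fin_cases i <;> (simp; try ring)
  · simp only [JInChart_apply, contact_line, quatDir_line, one_add_norm_sq_line, div_eq_mul_inv]
    simp

theorem fderiv_JInChart (x : CP3) (h v : C3) :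
    fderiv ℝ (JInChart x) 0 h v =
      -(2 * Complex.I) • !₂[area h v, -(v 0 * star (h 2)), v 0 * star (h 1)] := by
  have smooth : Differentiable ℝ (JInChart x) :=
    (contDiff_JInChart x).differentiable (by simp)
  rw [← fderiv_apply_eq_of_line (smooth.clm_apply (differentiable_const v) 0)
      (hasDerivAt_JInChart_line x h v),
    fderiv_clm_apply (smooth 0) (differentiableAt_const v)]
  simp

/-! ### The Levi-Civita connection and `G` at the centre of a chart -/

theorem nkMetric_self_pos (x : CP3) {v : T x} (hv : v ≠ 0) : 0 < nkMetric x v v := by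
  have coord_le : ‖(v : C3) 0‖ ^ 2 ≤ ‖(v : C3)‖ ^ 2 := by
    gcongr
    exact PiLp.norm_apply_le (v : C3) 0
  have norm_pos : 0 < ‖(v : C3)‖ := norm_pos_iff.2 hv
  have h : nkMetric x v v = 2 * ‖(v : C3)‖ ^ 2 - ‖(v : C3) 0‖ ^ 2 := by
    rw [nkMetric_apply, inner_self_eq_norm_sq_to_K, RCLike.star_def, RCLike.conj_mul]
    simp [← Complex.ofReal_pow]
  nlinarith

theorem metricInChart_zero (x : CP3) (u v : C3) : metricInChart x 0 u v = nkMetric x u v := by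
  rw [metricInChart_apply, nkMetric_apply]
  simp [contact]

theorem metricInChart_zero_isInvertible (x : CP3) : (metricInChart x 0).IsInvertible := by
  have injective : Function.Injective (metricInChart x 0) := by
    refine (injective_iff_map_eq_zero _).2 fun u hu => ?_
    by_contra hu0
    have self_eq_zero : metricInChart x 0 u u = 0 := by rw [hu]; rfl
    rw [metricInChart_zero] at self_eq_zero
    exact (nkMetric_self_pos x hu0).ne' self_eq_zero
  have finrank_eq : Module.finrank ℝ C3 = Module.finrank ℝ (C3 →L[ℝ] ℝ) := by
    rw [← LinearEquiv.finrank_eq (LinearMap.toContinuousLinearMap (𝕜 := ℝ) (E := C3) (F' := ℝ))]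
    exact (Subspace.dual_finrank_eq (K := ℝ) (V := C3)).symm
  exact ⟨(LinearEquiv.ofInjectiveOfFinrankEq
    (metricInChart x 0 : C3 →ₗ[ℝ] (C3 →L[ℝ] ℝ)) injective finrank_eq).toContinuousLinearEquiv, rfl⟩

theorem christoffel_zero (x : CP3) (u v : C3) : christoffel x 0 u v =
    (1 / 2 : ℂ) •
      !₂[0, v 0 * star (u 2) + u 0 * star (v 2), -(v 0 * star (u 1) + u 0 * star (v 1))] := by
  rw [← (metricInChart_zero_isInvertible x).inverse_apply_self ((1 / 2 : ℂ) • _)]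
  refine congrArg (metricInChart x 0).inverse (ContinuousLinearMap.ext fun w => ?_)
  change (1 / 2 : ℝ) * (fderiv ℝ (metricInChart x) 0 u v w + fderiv ℝ (metricInChart x) 0 v u w -
    fderiv ℝ (metricInChart x) 0 w u v) = _
  rw [fderiv_metricInChart, fderiv_metricInChart, fderiv_metricInChart, metricInChart_zero,
    nkMetric_apply, inner_C3]
  simp [area]
  ring

theorem JInChart_zero (x : CP3) (v : C3) : JInChart x 0 v = J x v := by
  rw [JInChart_apply, J_apply]
  ext i
  fin_cases i
  · simp [contact, quatDir]
    ring
  all_goals simp [quatDir]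

/-- Up to conjugations and constants, `G` is the complex cross product of `ℂ³`. -/
theorem G_apply (x : CP3) (u v : T x) : G x u v = Complex.I •
    !₂[-(2 * area u v), v 0 * star (u 2) - u 0 * star (v 2),
      u 0 * star (v 1) - v 0 * star (u 1)] := by
  change fderiv ℝ (JInChart x) (chartAt C3 x x) u v +
    christoffel x (chartAt C3 x x) u (JInChart x (chartAt C3 x x) v) -
    JInChart x (chartAt C3 x x) (christoffel x (chartAt C3 x x) u v) = _
  rw [chartAt_self, fderiv_JInChart, christoffel_zero, christoffel_zero, JInChart_zero,
    JInChart_zero, J_apply, J_apply]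
  ext i
  fin_cases i <;> simp [area] <;> ring

/-! ### Adapted frames at a point -/

/-- The Hermitian form `g(u, v) + i g(u, J v)`. The first component enters conjugated, since `J` is
multiplication by `-i` on it and by `i` on the other two. -/
def nkHerm (u v : C3) : ℂ := u 0 * star (v 0) + 2 * (star (u 1) * v 1 + star (u 2) * v 2)

theorem nkMetric_eq_re_nkHerm (x : CP3) (u v : T x) : nkMetric x u v = (nkHerm u v).re := by
  simp [nkMetric_apply, inner_C3, nkHerm]
  ring

theorem star_nkHerm (u v : C3) : star (nkHerm u v) = nkHerm v u := by
  simp [nkHerm]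
  ring

theorem nkHerm_add_left (u v w : C3) : nkHerm (u + v) w = nkHerm u w + nkHerm v w := by
  simp [nkHerm]
  ring

theorem nkHerm_smul_left (p : ℝ) (u v : C3) : nkHerm (p • u) v = p * nkHerm u v := by
  simp [nkHerm]
  ring

theorem nkHerm_add_right (u v w : C3) : nkHerm u (v + w) = nkHerm u v + nkHerm u w := by
  rw [← star_nkHerm, nkHerm_add_left, star_add, star_nkHerm, star_nkHerm]

theorem nkHerm_smul_right (p : ℝ) (u v : C3) : nkHerm u (p • v) = p * nkHerm u v := by
  rw [← star_nkHerm, nkHerm_smul_left, star_mul', star_nkHerm, RCLike.star_def, Complex.conj_ofReal]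

theorem nkHerm_J_right (x : CP3) (u v : T x) : nkHerm u (J x v) = Complex.I * nkHerm u v := by
  simp [J_apply, nkHerm]
  ring

theorem nkHerm_J_left (x : CP3) (u v : T x) : nkHerm (J x u) v = -(Complex.I * nkHerm u v) := by
  rw [← star_nkHerm, nkHerm_J_right, star_mul', star_nkHerm]
  simp

theorem nkHerm_left_G (x : CP3) (u v : T x) : nkHerm u (G x u v) = 0 := by
  simp [G_apply, nkHerm, area]
  ring

theorem nkHerm_right_G (x : CP3) (u v : T x) : nkHerm v (G x u v) = 0 := by
  simp [G_apply, nkHerm, area]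
  ring

theorem nkHerm_G_self (x : CP3) (u v : T x) :
    nkHerm (G x u v) (G x u v) = nkHerm u u * nkHerm v v - nkHerm u v * nkHerm v u := by
  have I_sq : Complex.I ^ 2 = -1 := Complex.I_sq
  simp [G_apply, nkHerm, area]
  ring_nf
  rw [I_sq]
  ring

/-- A pair of vectors that is orthonormal for `nkHerm`: it is `g`-orthonormal and spans a plane
which `J` maps to its `g`-orthogonal complement. -/
structure IsUnitaryPair (x : CP3) (u v : T x) : Prop where
  self_left : nkHerm u u = 1
  self_right : nkHerm v v = 1
  cross : nkHerm u v = 0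

theorem nkHerm_self_im (u : C3) : (nkHerm u u).im = 0 :=
  Complex.conj_eq_iff_im.1 (star_nkHerm u u)

/-- Orthonormality of the rows of a square matrix gives orthonormality of its columns. -/
theorem column_of_nkHerm_eq_ite {w : Fin 3 → C3}
    (h : ∀ i k, nkHerm (w i) (w k) = if i = k then 1 else 0) :
    ∑ i, w i 0 * star (w i 0) = 1 ∧ ∑ i, w i 0 * w i 1 = 0 ∧ ∑ i, w i 0 * w i 2 = 0 := by
  let A : Matrix (Fin 3) (Fin 3) ℂ := .of fun i => ![star (w i 0), w i 1, w i 2]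
  let B : Matrix (Fin 3) (Fin 3) ℂ := (Matrix.of fun i =>
    ![w i 0, 2 * star (w i 1), 2 * star (w i 2)]).transpose
  have rows : A * B = 1 := by
    ext i k
    have entry : (A * B) i k = nkHerm (w k) (w i) := by
      simp [Matrix.mul_apply, Fin.sum_univ_three, A, B, nkHerm]
      ring
    simp only [entry, h, Matrix.one_apply, eq_comm]
  have columns (k : Fin 3) : ∑ i, B 0 i * A i k = (1 : Matrix (Fin 3) (Fin 3) ℂ) 0 k := by
    rw [← mul_eq_one_comm.1 rows, Matrix.mul_apply]
  exact ⟨columns 0, columns 1, columns 2⟩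

namespace IsUnitaryPair

variable {x : CP3} {u v : T x}

theorem of_isOrthonormalPair (h : IsOrthonormalPair x u v) (hJ : nkMetric x u (J x v) = 0) :
    IsUnitaryPair x u v := by
  obtain ⟨self_left, self_right, cross⟩ := h
  rw [nkMetric_eq_re_nkHerm] at self_left self_right cross hJ
  refine ⟨Complex.ext self_left (nkHerm_self_im u), Complex.ext self_right (nkHerm_self_im v),
    Complex.ext cross ?_⟩
  simpa [nkHerm_J_right] using hJ

theorem isOrthonormalPair (h : IsUnitaryPair x u v) : IsOrthonormalPair x u v := by
  simp only [IsOrthonormalPair, nkMetric_eq_re_nkHerm, h.self_left, h.self_right, h.cross,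
    Complex.one_re, Complex.zero_re, and_self]

theorem nkHerm_frame (h : IsUnitaryPair x u v) (i k : Fin 3) :
    nkHerm (![u, v, G x u v] i) (![u, v, G x u v] k) = if i = k then 1 else 0 := by
  have swap {a b : C3} (hab : nkHerm a b = 0) : nkHerm b a = 0 := by
    rw [← star_nkHerm, hab, star_zero]
  fin_cases i <;> fin_cases k
  · exact h.self_left
  · exact h.cross
  · exact nkHerm_left_G x u v
  · exact swap h.cross
  · exact h.self_right
  · exact nkHerm_right_G x u v
  · exact swap (nkHerm_left_G x u v)
  · exact swap (nkHerm_right_G x u v)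
  · refine (nkHerm_G_self x u v).trans ?_
    simp [h.self_left, h.self_right, h.cross]

theorem isAdaptedFrame (h : IsUnitaryPair x u v) : IsAdaptedFrame x u v := by
  have frame := h.nkHerm_frame
  simp only [Fin.forall_fin_succ] at frame
  intro i k
  rw [nkMetric_eq_re_nkHerm]
  fin_cases i <;> fin_cases k <;>
    simp_all [adaptedFrame, nkHerm_J_left, nkHerm_J_right]

theorem first_column (h : IsUnitaryPair x u v) :
    u 0 * star (u 0) + v 0 * star (v 0) + G x u v 0 * star (G x u v 0) = 1 := by
  simpa [Fin.sum_univ_three] using (column_of_nkHerm_eq_ite h.nkHerm_frame).1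

theorem column_orthogonal (h : IsUnitaryPair x u v) :
    u 0 * u 1 + v 0 * v 1 + G x u v 0 * G x u v 1 = 0 ∧
      u 0 * u 2 + v 0 * v 2 + G x u v 0 * G x u v 2 = 0 := by
  simpa [Fin.sum_univ_three] using (column_of_nkHerm_eq_ite h.nkHerm_frame).2

theorem fsMetric_eq (h : IsUnitaryPair x u v) :
    fsMetric x u v = (1 / 2) * (star (u 0) * v 0).re := by
  have re_cross := nkMetric_eq_re_nkHerm x u v
  rw [h.cross, nkMetric_apply, two_mul, Complex.sub_re, Complex.add_re, Complex.zero_re] at re_cross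
  rw [fsMetric_apply]
  linarith

/-- Each summand is the complex multiple `(conj z * w₀) • w` of a frame vector `w`, the scalar `i`
acting by `J`. -/
theorem axis_eq_sum (h : IsUnitaryPair x u v) (z : ℂ) : (!₂[z, 0, 0] : C3) =
    ((star z * u 0).re • u + (star z * u 0).im • J x u) +
      ((star z * v 0).re • v + (star z * v 0).im • J x v) +
        ((star z * G x u v 0).re • G x u v + (star z * G x u v 0).im • J x (G x u v)) := by
  have combination_apply (k : ℂ) (w : T x) :
      k.re • w + k.im • J x w = !₂[star k * w 0, k * w 1, k * w 2] := by
    rw [J_apply]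
    ext i
    fin_cases i <;> simp [Complex.ext_iff] <;> ring_nf
  obtain ⟨orthogonal_one, orthogonal_two⟩ := h.column_orthogonal
  simp only [combination_apply]
  ext i
  fin_cases i
  · have unit := h.first_column
    simp only [Complex.star_def] at unit
    simp
    linear_combination -z * unit
  · simp
    linear_combination -starRingEnd ℂ z * orthogonal_one
  · simp
    linear_combination -starRingEnd ℂ z * orthogonal_two

end IsUnitaryPair

theorem J₀_eq_J_add (x : CP3) (w : T x) : J₀ x w = J x w + !₂[2 * Complex.I * w 0, 0, 0] := by
  rw [J₀_apply, J_apply]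
  ext i
  fin_cases i
  · simp
    ring
  all_goals simp

namespace IsUnitaryPair

variable {x : CP3} {u v : T x}

theorem hasCoefficients (h : IsUnitaryPair x u v) (re_eq_zero : (star (u 0) * v 0).re = 0) :
    HasCoefficients x u v
      (2 * (star (u 0) * v 0).im)
      (1 - 2 * Complex.normSq (u 0))
      (2 * (star (u 0) * G x u v 0).im)
      (-2 * (star (u 0) * G x u v 0).re)
      (1 - 2 * Complex.normSq (v 0))
      (2 * (star (v 0) * G x u v 0).im)
      (-2 * (star (v 0) * G x u v 0).re) := by
  have coefficient_re (a b : ℂ) : (star (2 * Complex.I * a) * b).re = 2 * (star a * b).im := by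
    simp
    ring
  have coefficient_im (a b : ℂ) : (star (2 * Complex.I * a) * b).im = -2 * (star a * b).re := by
    simp
    ring
  have self (a : ℂ) : star a * a = Complex.normSq a := Complex.normSq_eq_conj_mul_self.symm
  have swap : star (v 0) * u 0 = star (star (u 0) * v 0) := by
    rw [star_mul', star_star, mul_comm]
  have swap_re : (star (v 0) * u 0).re = (star (u 0) * v 0).re := by rw [swap]; rfl
  have swap_im : (star (v 0) * u 0).im = -(star (u 0) * v 0).im := by rw [swap]; rfl
  constructor
  · rw [J₀_eq_J_add, h.axis_eq_sum]
    simp only [coefficient_re, coefficient_im, self, re_eq_zero, Complex.ofReal_re,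
      Complex.ofReal_im]
    module
  · rw [J₀_eq_J_add, h.axis_eq_sum]
    simp only [coefficient_re, coefficient_im, self, swap_re, swap_im, re_eq_zero,
      Complex.ofReal_re, Complex.ofReal_im]
    module

theorem eq_of_hasCoefficients (h : IsUnitaryPair x u v) {b₁ b₂ b₄ b₅ c₃ c₄ c₅ : ℝ}
    (hc : HasCoefficients x u v b₁ b₂ b₄ b₅ c₃ c₄ c₅) :
    (star (u 0) * v 0).re = 0 ∧ b₂ = 1 - 2 * Complex.normSq (u 0) ∧
      c₃ = 1 - 2 * Complex.normSq (v 0) := by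
  have metric_J (a b : T x) :
      nkMetric x (J₀ x a) (J x b) = (nkHerm a b).re - 2 * (star (a 0) * b 0).re := by
    rw [J₀_apply, J_apply, nkMetric_eq_re_nkHerm]
    simp [nkHerm]
    ring
  have frame := h.nkHerm_frame
  simp [Fin.forall_fin_succ] at frame
  have cross := metric_J u v
  have left := metric_J u u
  have right := metric_J v v
  rw [hc.1] at cross left
  rw [hc.2] at right
  simp [nkMetric_eq_re_nkHerm, nkHerm_J_left, nkHerm_J_right, frame] at cross left right
  simp only [Complex.normSq_apply, Complex.star_def, Complex.mul_re, Complex.conj_re,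
    Complex.conj_im]
  refine ⟨?_, ?_, ?_⟩ <;> linarith

end IsUnitaryPair

/-! ### The three types exclude each other -/

theorem IsOrthonormalPair.linearIndependent {x : CP3} {u v : T x} (h : IsOrthonormalPair x u v) :
    LinearIndependent ℝ ![(u : C3), v] := by
  obtain ⟨self_left, self_right, cross⟩ := h
  rw [LinearIndependent.pair_iff]
  intro s t combination_eq_zero
  have left : nkMetric x u (s • u + t • v) = s := by simp [self_left, cross]
  have right : nkMetric x (s • u + t • v) v = t := by simp [self_right, cross]
  rw [combination_eq_zero] at left right
  exact ⟨by simpa using left.symm, by simpa using right.symm⟩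

section OrthogonalCombination

variable {p r s t : ℝ} (hpr : p * p + r * r = 1) (hst : s * s + t * t = 1)
  (orthogonal : p * s + r * t = 0)
include hpr hst orthogonal

theorem normSq_add_normSq_of_orthogonal (z w : ℂ) :
    Complex.normSq (p * z + r * w) + Complex.normSq (s * z + t * w) =
      Complex.normSq z + Complex.normSq w := by
  have rows : !![p, r; s, t] * !![p, s; r, t] = 1 := by
    rw [Matrix.mul_fin_two, hpr, hst, orthogonal, mul_comm s, mul_comm t, orthogonal,
      Matrix.one_fin_two]
  have columns : !![p, s; r, t] * !![p, r; s, t] = 1 := mul_eq_one_comm.1 rows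
  simp only [Matrix.mul_fin_two, Matrix.one_fin_two, ← Matrix.ext_iff, Fin.forall_fin_two,
    Matrix.of_apply, Matrix.cons_val_zero, Matrix.cons_val_one] at columns
  obtain ⟨⟨hps, cross⟩, -, hrt⟩ := columns
  simp [Complex.normSq_apply]
  linear_combination (z.re ^ 2 + z.im ^ 2) * hps + (w.re ^ 2 + w.im ^ 2) * hrt +
    2 * (z.re * w.re + z.im * w.im) * cross

theorem im_star_mul_sq_of_orthogonal (z w : ℂ) :
    (star (p * z + r * w) * (s * z + t * w)).im ^ 2 = (star z * w).im ^ 2 := by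
  have det_sq : (p * t - r * s) ^ 2 = 1 := by
    linear_combination (s ^ 2 + t ^ 2) * hpr + hst - (p * s + r * t) * orthogonal
  simp
  linear_combination (z.re * w.im - z.im * w.re) ^ 2 * det_sq

end OrthogonalCombination

theorem normSq_mul_normSq_of_re_eq_zero {z w : ℂ} (h : (star z * w).re = 0) :
    Complex.normSq z * Complex.normSq w = (star z * w).im ^ 2 := by
  rw [← Complex.normSq_conj z, ← Complex.normSq_mul, Complex.normSq_apply, ← Complex.star_def, h]
  ring

namespace IsUnitaryPair

variable {x : CP3} {u v : T x}

theorem nkHerm_combination (h : IsUnitaryPair x u v) (p r s t : ℝ) :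
    nkHerm (p • u + r • v) (s • u + t • v) = (p * s + r * t : ℝ) := by
  have cross_swap : nkHerm v u = 0 := by rw [← star_nkHerm, h.cross, star_zero]
  simp only [nkHerm_add_left, nkHerm_add_right, nkHerm_smul_left, nkHerm_smul_right, h.self_left,
    h.self_right, h.cross, cross_swap]
  push_cast
  ring

/-- `1 - b₂` and `1 - c₃` are `2 |u₀|²` and `2 |v₀|²`; their sum and product are invariants of the
plane spanned by `u` and `v`. -/
theorem trace_det_eq (h : IsUnitaryPair x u v) {p r s t : ℝ}
    (h' : IsUnitaryPair x (p • u + r • v) (s • u + t • v))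
    {b₁ b₂ b₄ b₅ c₃ c₄ c₅ b₁' b₂' b₄' b₅' c₃' c₄' c₅' : ℝ}
    (hc : HasCoefficients x u v b₁ b₂ b₄ b₅ c₃ c₄ c₅)
    (hc' : HasCoefficients x (p • u + r • v) (s • u + t • v) b₁' b₂' b₄' b₅' c₃' c₄' c₅') :
    b₂ + c₃ = b₂' + c₃' ∧ b₂ * c₃ = b₂' * c₃' := by
  obtain ⟨re_eq_zero, hb₂, hc₃⟩ := h.eq_of_hasCoefficients hc
  obtain ⟨re_eq_zero', hb₂', hc₃'⟩ := h'.eq_of_hasCoefficients hc'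
  change (star (p * u 0 + r * v 0) * (s * u 0 + t * v 0)).re = 0 at re_eq_zero'
  have hpr : p * p + r * r = 1 :=
    Complex.ofReal_eq_one.1 ((h.nkHerm_combination p r p r).symm.trans h'.self_left)
  have hst : s * s + t * t = 1 :=
    Complex.ofReal_eq_one.1 ((h.nkHerm_combination s t s t).symm.trans h'.self_right)
  have orthogonal : p * s + r * t = 0 :=
    Complex.ofReal_eq_zero.1 ((h.nkHerm_combination p r s t).symm.trans h'.cross)
  have sum_eq := normSq_add_normSq_of_orthogonal hpr hst orthogonal (u 0) (v 0)
  have prod_eq := im_star_mul_sq_of_orthogonal hpr hst orthogonal (u 0) (v 0)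
  rw [← normSq_mul_normSq_of_re_eq_zero re_eq_zero,
    ← normSq_mul_normSq_of_re_eq_zero re_eq_zero'] at prod_eq
  change b₂' = 1 - 2 * Complex.normSq (p * u 0 + r * v 0) at hb₂'
  change c₃' = 1 - 2 * Complex.normSq (s * u 0 + t * v 0) at hc₃'
  subst hb₂ hc₃ hb₂' hc₃'
  constructor
  · linear_combination 2 * sum_eq
  · linear_combination 2 * sum_eq - 4 * prod_eq

end IsUnitaryPair

section Overlap

variable {M : Type*} [TopologicalSpace M] [ChartedSpace E2 M] {f : M → CP3} {q : M}

theorem IsTotallyReal.isUnitaryPair (hf : IsTotallyReal f) {u v : TangentSpace 𝓘(ℝ, E2) q}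
    (h : IsOrthonormalPair (f q) (push f q u) (push f q v)) :
    IsUnitaryPair (f q) (push f q u) (push f q v) :=
  .of_isOrthonormalPair h (hf.totallyReal q u v)

theorem push_add (u v : TangentSpace 𝓘(ℝ, E2) q) :
    push f q (u + v) = push f q u + push f q v := map_add (mfderiv 𝓘(ℝ, E2) 𝓘(ℝ, C3) f q) u v

theorem push_smul (a : ℝ) (u : TangentSpace 𝓘(ℝ, E2) q) :
    push f q (a • u) = a • push f q u := map_smul (mfderiv 𝓘(ℝ, E2) 𝓘(ℝ, C3) f q) a u

theorem exists_combination {u v : TangentSpace 𝓘(ℝ, E2) q}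
    (h : IsOrthonormalPair (f q) (push f q u) (push f q v)) (w : TangentSpace 𝓘(ℝ, E2) q) :
    ∃ a b : ℝ, push f q w = a • push f q u + b • push f q v := by
  let L : E2 →L[ℝ] C3 := mfderiv 𝓘(ℝ, E2) 𝓘(ℝ, C3) f q
  have independent : LinearIndependent ℝ ![(u : E2), v] := by
    have image : ![push f q u, push f q v] = L ∘ ![(u : E2), v] := by
      funext i
      fin_cases i <;> rfl
    have image_independent := h.linearIndependent
    rw [image] at image_independent
    exact .of_comp L.toLinearMap image_independent
  have finrank_eq : Module.finrank ℝ E2 = 2 := finrank_euclideanSpace_fin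
  have mem_span : (w : E2) ∈ Submodule.span ℝ (Set.range ![(u : E2), v]) := by
    rw [independent.span_eq_top_of_card_eq_finrank ((Fintype.card_fin 2).trans finrank_eq.symm)]
    trivial
  rw [Matrix.range_cons, Matrix.range_cons, Matrix.range_empty, Set.union_empty,
    Set.singleton_union, Submodule.mem_span_pair] at mem_span
  obtain ⟨a, b, rfl⟩ := mem_span
  exact ⟨a, b, by rw [← push_smul, ← push_smul, ← push_add]⟩

theorem IsTotallyReal.trace_det_eq (hf : IsTotallyReal f)
    {u v u' v' : TangentSpace 𝓘(ℝ, E2) q}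
    (h : IsOrthonormalPair (f q) (push f q u) (push f q v))
    (h' : IsOrthonormalPair (f q) (push f q u') (push f q v'))
    {b₁ b₂ b₄ b₅ c₃ c₄ c₅ b₁' b₂' b₄' b₅' c₃' c₄' c₅' : ℝ}
    (hc : HasCoefficients (f q) (push f q u) (push f q v) b₁ b₂ b₄ b₅ c₃ c₄ c₅)
    (hc' : HasCoefficients (f q) (push f q u') (push f q v') b₁' b₂' b₄' b₅' c₃' c₄' c₅') :
    b₂ + c₃ = b₂' + c₃' ∧ b₂ * c₃ = b₂' * c₃' := by
  obtain ⟨p, r, hu⟩ := exists_combination h u'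
  obtain ⟨s, t, hv⟩ := exists_combination h v'
  have pair' := hf.isUnitaryPair h'
  rw [hu, hv] at pair' hc'
  exact (hf.isUnitaryPair h).trace_det_eq pair' hc hc'

theorem type0_trace (l s : ℝ) :
    (l ^ 2 + s) / (1 + l ^ 2) + (1 + l ^ 2 * s) / (1 + l ^ 2) = 1 + s := by
  field_simp
  ring

theorem not_isType0At_and_isType1At (hf : IsTotallyReal f) :
    ¬ (IsType0At f q ∧ IsType1At f q) := by
  rintro ⟨⟨u, v, h, l, α, θ, hα, exclusion, hc⟩, ⟨u', v', h', hc'⟩⟩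
  obtain ⟨trace_eq, det_eq⟩ := hf.trace_det_eq h h' hc hc'
  rw [type0_trace] at trace_eq
  have sin_eq_zero : Real.sin α = 0 := by linarith
  have α_eq_zero : α = 0 :=
    (Real.sin_eq_zero_iff_of_lt_of_lt (by linarith [hα.1, Real.pi_pos])
      (by linarith [hα.2, Real.pi_pos])).1 sin_eq_zero
  rw [sin_eq_zero] at det_eq
  field_simp at det_eq
  exact exclusion ⟨by nlinarith [sq_nonneg (l ^ 2 - 1)], α_eq_zero⟩

theorem not_isType0At_and_isType2At (hf : IsTotallyReal f) :
    ¬ (IsType0At f q ∧ IsType2At f q) := by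
  rintro ⟨⟨u, v, h, l, α, θ, hα, -, hc⟩, ⟨u', v', h', β, hc'⟩⟩
  obtain ⟨trace_eq, -⟩ := hf.trace_det_eq h h' hc hc'
  rw [type0_trace] at trace_eq
  have neg_one_lt_sin : Real.sin (-(Real.pi / 2)) < Real.sin α :=
    Real.sin_lt_sin_of_lt_of_le_pi_div_two le_rfl hα.2.le hα.1
  rw [Real.sin_neg, Real.sin_pi_div_two] at neg_one_lt_sin
  linarith

theorem not_isType1At_and_isType2At (hf : IsTotallyReal f) :
    ¬ (IsType1At f q ∧ IsType2At f q) := by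
  rintro ⟨⟨u, v, h, hc⟩, ⟨u', v', h', β, hc'⟩⟩
  obtain ⟨trace_eq, -⟩ := hf.trace_det_eq h h' hc hc'
  linarith

end Overlap

/-! ### Components of a frame up to a phase -/

theorem G_combination (x : CP3) (u v : T x) (p r s t : ℝ) :
    G x (p • u + r • v) (s • u + t • v) = (p * t - r * s) • G x u v := by
  rw [G_apply, G_apply]
  ext i
  fin_cases i <;> (simp [area]; ring)

/-- `u`, `v` is a unitary pair, and `a`, `b`, `c` are the first components of `u`, `v`, `G(u, v)`,
which span `𝒟₁²`, up to a common phase. The phase depends on the chart, whereas the coefficients of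
`J_∘` depend on `a`, `b`, `c` only. -/
structure HasComponents (x : CP3) (u v : T x) (a b c : ℂ) : Prop where
  isUnitaryPair : IsUnitaryPair x u v
  exists_phase : ∃ e : ℂ, e * star e = 1 ∧ u 0 = e * a ∧ v 0 = e * b ∧ G x u v 0 = e * c

theorem star_phase_mul_mul {e : ℂ} (he : e * star e = 1) (z w : ℂ) :
    star (e * z) * (e * w) = star z * w := by
  rw [star_mul']
  linear_combination star z * w * he

theorem normSq_phase_mul {e : ℂ} (he : e * star e = 1) (z : ℂ) :
    Complex.normSq (e * z) = Complex.normSq z := by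
  have normSq_e : Complex.normSq e = 1 := by
    rw [Complex.star_def, Complex.mul_conj] at he
    exact_mod_cast he
  rw [Complex.normSq_mul, normSq_e, one_mul]

namespace HasComponents

variable {x : CP3} {u v : T x} {a b c : ℂ}

theorem mul_phase (h : HasComponents x u v a b c) {e : ℂ} (he : e * star e = 1) :
    HasComponents x u v (e * a) (e * b) (e * c) := by
  obtain ⟨pair, d, hd, hu, hv, hG⟩ := h
  have cancel (z : ℂ) : d * z = d * star e * (e * z) := by linear_combination -(d * z) * he
  refine ⟨pair, d * star e, ?_, hu.trans (cancel a), hv.trans (cancel b), hG.trans (cancel c)⟩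
  rw [star_mul', star_star]
  linear_combination d * star d * he + hd

theorem rotate (h : HasComponents x u v a b c) {p r : ℝ} (hpr : p ^ 2 + r ^ 2 = 1) :
    HasComponents x (p • u + r • v) (-r • u + p • v) (p * a + r * b) (-r * a + p * b) c := by
  obtain ⟨pair, e, he, hu, hv, hG⟩ := h
  refine ⟨⟨?_, ?_, ?_⟩, e, he, ?_, ?_, ?_⟩
  · rw [pair.nkHerm_combination, ← sq, ← sq, hpr, Complex.ofReal_one]
  · rw [pair.nkHerm_combination, ← sq, ← sq, neg_sq, add_comm, hpr, Complex.ofReal_one]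
  · rw [pair.nkHerm_combination, mul_comm r p, mul_neg, neg_add_cancel, Complex.ofReal_zero]
  · simp [hu, hv]
    ring
  · simp [hu, hv]
    ring
  · rw [G_combination, mul_neg, sub_neg_eq_add, ← sq, ← sq, hpr, one_smul, hG]

theorem reflect (h : HasComponents x u v a b c) : HasComponents x u (-v) a (-b) (-c) := by
  obtain ⟨pair, e, he, hu, hv, hG⟩ := h
  have G_neg : G x u (-v) = -G x u v := by simpa using G_combination x u v 1 0 0 (-1)
  refine ⟨⟨pair.self_left, ?_, ?_⟩, e, he, hu, ?_, ?_⟩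
  · simpa using pair.nkHerm_combination 0 (-1) 0 (-1)
  · simpa using pair.nkHerm_combination 1 0 0 (-1)
  · rw [PiLp.neg_apply, hv, mul_neg]
  · rw [G_neg, PiLp.neg_apply, hG, mul_neg]

theorem sum_normSq (h : HasComponents x u v a b c) :
    Complex.normSq a + Complex.normSq b + Complex.normSq c = 1 := by
  obtain ⟨pair, e, he, hu, hv, hG⟩ := h
  have unit := pair.first_column
  simp only [hu, hv, hG, Complex.star_def, Complex.mul_conj, normSq_phase_mul he] at unit
  exact_mod_cast unit

theorem fsMetric_eq (h : HasComponents x u v a b c) :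
    fsMetric x u v = 1 / 2 * (star a * b).re := by
  obtain ⟨pair, e, he, hu, hv, -⟩ := h
  rw [pair.fsMetric_eq, hu, hv, star_phase_mul_mul he]

theorem hasCoefficients (h : HasComponents x u v a b c) (re_eq_zero : (star a * b).re = 0) :
    HasCoefficients x u v (2 * (star a * b).im) (1 - 2 * Complex.normSq a) (2 * (star a * c).im)
      (-2 * (star a * c).re) (1 - 2 * Complex.normSq b) (2 * (star b * c).im)
      (-2 * (star b * c).re) := by
  obtain ⟨pair, e, he, hu, hv, hG⟩ := h
  have coefficients := pair.hasCoefficients (by rwa [hu, hv, star_phase_mul_mul he])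
  simpa only [hu, hv, hG, star_phase_mul_mul he, normSq_phase_mul he] using coefficients

end HasComponents

/-! ### The normal forms at a point -/

theorem cos_arctan_div {r t : ℝ} (hr : 0 < r) (h : r ^ 2 + t ^ 2 = 1) :
    Real.cos (Real.arctan (t / r)) = r := by
  have one_add_sq : 1 + (t / r) ^ 2 = (1 / r) ^ 2 := by
    field_simp
    exact h
  rw [Real.cos_arctan, one_add_sq, Real.sqrt_sq (by positivity), one_div_one_div]

theorem sin_arctan_div {r t : ℝ} (hr : 0 < r) (h : r ^ 2 + t ^ 2 = 1) :
    Real.sin (Real.arctan (t / r)) = t := by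
  rw [← Real.tan_mul_cos (Real.cos_arctan_pos _).ne', Real.tan_arctan, cos_arctan_div hr h,
    div_mul_cancel₀ _ hr.ne']

theorem cos_arcsin_two_mul_sq_sub_one {n : ℝ} (hn : 0 ≤ n) :
    Real.cos (Real.arcsin (2 * n ^ 2 - 1)) = 2 * n * √(1 - n ^ 2) := by
  rw [Real.cos_arcsin, show 1 - (2 * n ^ 2 - 1) ^ 2 = (2 * n) ^ 2 * (1 - n ^ 2) by ring,
    Real.sqrt_mul (sq_nonneg _), Real.sqrt_sq (by positivity)]

theorem cos_arcsin_div_sqrt {r t n : ℝ} (hr : 0 < r) (hn : 0 ≤ n) (h : r ^ 2 + t ^ 2 + n ^ 2 = 1) :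
    Real.cos (Real.arcsin (2 * n ^ 2 - 1)) / √(1 + (t / r) ^ 2) = 2 * n * r := by
  have one_sub_sq : 1 - n ^ 2 = r ^ 2 * (1 + (t / r) ^ 2) := by
    field_simp
    linarith
  rw [cos_arcsin_two_mul_sq_sub_one hn, one_sub_sq, Real.sqrt_mul (sq_nonneg r),
    Real.sqrt_sq hr.le]
  field_simp

namespace HasComponents

variable {x : CP3} {u v : T x} {r t : ℝ} {c : ℂ}

theorem sum_sq (h : HasComponents x u v r (Complex.I * t) c) : r ^ 2 + t ^ 2 + ‖c‖ ^ 2 = 1 := by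
  have sum := h.sum_normSq
  simp only [map_mul, Complex.normSq_ofReal, Complex.normSq_I, one_mul] at sum
  rw [← Complex.normSq_eq_norm_sq, sq, sq, sum]

theorem re_star_mul_axis (r t : ℝ) : (star (r : ℂ) * (Complex.I * t)).re = 0 := by simp

theorem fsMetric_eq_zero (h : HasComponents x u v r (Complex.I * t) c) : fsMetric x u v = 0 := by
  rw [h.fsMetric_eq, re_star_mul_axis, mul_zero]

theorem hasCoefficients_axes (h : HasComponents x u v r (Complex.I * t) c) :
    HasCoefficients x u v (2 * (r * t)) (1 - 2 * r ^ 2) (2 * (r * c.im)) (-2 * (r * c.re))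
      (1 - 2 * t ^ 2) (-2 * (t * c.re)) (-2 * (t * c.im)) := by
  convert h.hasCoefficients (re_star_mul_axis r t) using 1 <;> simp [Complex.normSq_apply] <;> ring

theorem type2 (h : HasComponents x u v r (Complex.I * t) 0) (hr : 0 < r) :
    Type2 x u v (2 * Real.arctan (t / r) - Real.pi / 2) := by
  have sum : r ^ 2 + t ^ 2 = 1 := by simpa using h.sum_sq
  have coefficients := h.hasCoefficients_axes
  unfold Type2
  rw [Real.cos_sub_pi_div_two, Real.sin_sub_pi_div_two, Real.sin_two_mul, Real.cos_two_mul,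
    sin_arctan_div hr sum, cos_arctan_div hr sum]
  convert coefficients using 1
  · ring
  · ring
  · simp
  · simp
  · linarith
  · simp
  · simp

theorem type1 (h : HasComponents x u v (1 / 2 : ℝ) (Complex.I * (1 / 2 : ℝ))
    (Complex.I * (1 / √2 : ℝ))) : Type1 x u v := by
  have coefficients := h.hasCoefficients_axes
  simp only [Complex.I_mul_re, Complex.I_mul_im, Complex.ofReal_re, Complex.ofReal_im]
    at coefficients
  unfold Type1
  convert coefficients using 1 <;> ring

theorem type0 (h : HasComponents x u v r (Complex.I * t) c) (hr : 0 < r) (hc : c ≠ 0)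
    (exclusion : ¬ (t ^ 2 = r ^ 2 ∧ ‖c‖ ^ 2 = 1 / 2)) {θ : ℝ}
    (hcos : ‖c‖ * Real.cos θ = -c.re) (hsin : ‖c‖ * Real.sin θ = c.im) :
    Type0 x u v (t / r) (Real.arcsin (2 * ‖c‖ ^ 2 - 1)) θ := by
  have sum := h.sum_sq
  have norm_sq_pos : 0 < ‖c‖ ^ 2 := by positivity
  have norm_sq_lt : ‖c‖ ^ 2 < 1 := by nlinarith
  have sin_eq : Real.sin (Real.arcsin (2 * ‖c‖ ^ 2 - 1)) = 2 * ‖c‖ ^ 2 - 1 :=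
    Real.sin_arcsin (by linarith) (by linarith)
  have cos_div := cos_arcsin_div_sqrt hr (norm_nonneg c) sum
  refine ⟨⟨Real.neg_pi_div_two_lt_arcsin.2 (by linarith),
    Real.arcsin_lt_pi_div_two.2 (by linarith)⟩, fun ⟨hl, hα⟩ => exclusion ⟨?_, ?_⟩, ?_⟩
  · rwa [div_pow, div_eq_one_iff_eq (by positivity)] at hl
  · linarith [Real.arcsin_eq_zero_iff.1 hα]
  have coefficients := h.hasCoefficients_axes
  rw [sin_eq, mul_div_right_comm _ (Real.sin θ), mul_div_right_comm _ (Real.cos θ),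
    mul_assoc (t / r), mul_assoc (t / r), mul_div_assoc (t / r), mul_div_assoc (t / r),
    mul_div_right_comm _ (Real.sin θ), mul_div_right_comm _ (Real.cos θ), cos_div]
  convert coefficients using 1
  · field_simp
    linear_combination (-2 * t) * sum
  · field_simp
    linear_combination 2 * r ^ 2 * sum
  · linear_combination 2 * r * hsin
  · linear_combination 2 * r * hcos
  · field_simp
    linear_combination 2 * t ^ 2 * sum
  · field_simp
    linear_combination t * hcos
  · field_simp
    linear_combination -t * hsin

end HasComponents

/-! ### Smooth maps on a surface -/

section SmoothMaps

variable {M : Type*} [TopologicalSpace M] [ChartedSpace E2 M]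

/-- The map `a` from the surface to a normed space is smooth on `N`. For real functions this is
`SmoothFunOn`. -/
def SmoothMapOn {F : Type*} [NormedAddCommGroup F] [NormedSpace ℝ F] (N : Set M) (a : M → F) :
    Prop :=
  ContMDiffOn 𝓘(ℝ, E2) 𝓘(ℝ, F) ∞ a N

namespace SmoothMapOn

variable {F F' : Type*} [NormedAddCommGroup F] [NormedSpace ℝ F] [NormedAddCommGroup F']
  [NormedSpace ℝ F'] {N : Set M}

theorem contDiffAt_comp {a : M → F} {φ : F → F'} (ha : SmoothMapOn N a)
    (hφ : ∀ q ∈ N, ContDiffAt ℝ ∞ φ (a q)) : SmoothMapOn N (fun q => φ (a q)) :=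
  fun q hq => (hφ q hq).comp_contMDiffWithinAt (ha q hq)

theorem contDiff_comp {a : M → F} {φ : F → F'} (ha : SmoothMapOn N a) (hφ : ContDiff ℝ ∞ φ) :
    SmoothMapOn N (fun q => φ (a q)) :=
  ha.contDiffAt_comp fun _ _ => hφ.contDiffAt

theorem prodMk {a : M → F} {b : M → F'} (ha : SmoothMapOn N a) (hb : SmoothMapOn N b) :
    SmoothMapOn N (fun q => (a q, b q)) :=
  ContMDiffOn.prodMk_space ha hb

theorem const (c : F) : SmoothMapOn N (fun _ => c) := contMDiffOn_const

theorem add {a b : M → F} (ha : SmoothMapOn N a) (hb : SmoothMapOn N b) :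
    SmoothMapOn N (fun q => a q + b q) :=
  ContMDiffOn.add ha hb

theorem sub {a b : M → F} (ha : SmoothMapOn N a) (hb : SmoothMapOn N b) :
    SmoothMapOn N (fun q => a q - b q) :=
  ContMDiffOn.sub ha hb

theorem neg {a : M → F} (ha : SmoothMapOn N a) : SmoothMapOn N (fun q => -a q) :=
  ContMDiffOn.neg ha

theorem mul {A : Type*} [NormedRing A] [NormedAlgebra ℝ A] {a b : M → A} (ha : SmoothMapOn N a)
    (hb : SmoothMapOn N b) : SmoothMapOn N (fun q => a q * b q) :=
  (ha.prodMk hb).contDiff_comp contDiff_mul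

theorem div {K : Type*} [NormedField K] [NormedAlgebra ℝ K] {a b : M → K}
    (ha : SmoothMapOn N a) (hb : SmoothMapOn N b) (hne : ∀ q ∈ N, b q ≠ 0) :
    SmoothMapOn N (fun q => a q / b q) := by
  simp only [div_eq_mul_inv]
  exact ha.mul (hb.contDiffAt_comp fun q hq => contDiffAt_inv ℝ (hne q hq))

theorem sqrt {a : M → ℝ} (ha : SmoothMapOn N a) (hne : ∀ q ∈ N, a q ≠ 0) :
    SmoothMapOn N (fun q => √(a q)) :=
  ha.contDiffAt_comp fun q hq => Real.contDiffAt_sqrt (hne q hq)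

theorem ofReal {a : M → ℝ} (ha : SmoothMapOn N a) : SmoothMapOn N (fun q => (a q : ℂ)) :=
  ha.contDiff_comp Complex.ofRealCLM.contDiff

theorem re {a : M → ℂ} (ha : SmoothMapOn N a) : SmoothMapOn N (fun q => (a q).re) :=
  ha.contDiff_comp Complex.reCLM.contDiff

theorem im {a : M → ℂ} (ha : SmoothMapOn N a) : SmoothMapOn N (fun q => (a q).im) :=
  ha.contDiff_comp Complex.imCLM.contDiff

theorem star {a : M → ℂ} (ha : SmoothMapOn N a) : SmoothMapOn N (fun q => star (a q)) :=
  ha.contDiff_comp Complex.conjCLE.contDiff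

theorem norm {a : M → ℂ} (ha : SmoothMapOn N a) (hne : ∀ q ∈ N, a q ≠ 0) :
    SmoothMapOn N (fun q => ‖a q‖) :=
  ha.contDiffAt_comp fun q hq => contDiffAt_norm ℝ (hne q hq)

theorem mono {a : M → F} {N' : Set M} (ha : SmoothMapOn N a) (h : N' ⊆ N) : SmoothMapOn N' a :=
  ContMDiffOn.mono ha h

theorem isOpen_inter_preimage {a : M → F} (ha : SmoothMapOn N a) (hN : IsOpen N) {s : Set F}
    (hs : IsOpen s) : IsOpen (N ∩ a ⁻¹' s) :=
  (ContMDiffOn.continuousOn ha).isOpen_inter_preimage hN hs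

theorem exists_local_log {z : M → ℂ} (hz : SmoothMapOn N z) (hN : IsOpen N) {q₁ : M} (hq₁ : q₁ ∈ N)
    (hne : z q₁ ≠ 0) : ∃ N' ⊆ N, IsOpen N' ∧ q₁ ∈ N' ∧
      ∃ w : M → ℂ, SmoothMapOn N' w ∧ ∀ q ∈ N', Complex.exp (w q) = z q := by
  have quotient : SmoothMapOn N (fun q => z q / z q₁) := hz.div (const _) fun _ _ => hne
  refine ⟨N ∩ (fun q => z q / z q₁) ⁻¹' Complex.slitPlane, Set.inter_subset_left,
    quotient.isOpen_inter_preimage hN Complex.isOpen_slitPlane, ⟨hq₁, ?_⟩,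
    fun q => Complex.log (z q / z q₁) + Complex.log (z q₁), ?_, fun q hq => ?_⟩
  · rw [Set.mem_preimage, div_self hne]
    exact Complex.one_mem_slitPlane
  · exact ((quotient.mono Set.inter_subset_left).contDiffAt_comp fun q hq =>
      (Complex.contDiffAt_log hq.2).restrict_scalars ℝ).add (const _)
  · rw [Complex.exp_add, Complex.exp_log (Complex.slitPlane_ne_zero hq.2), Complex.exp_log hne,
      div_mul_cancel₀ _ hne]

end SmoothMapOn

end SmoothMaps

/-! ### The surface in a chart -/

section InChart

variable {M : Type*} {f : M → CP3}

/-- The part of the surface that the preferred chart at `x` covers. -/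
def chartDomain (f : M → CP3) (x : CP3) : Set M := f ⁻¹' (chartAt C3 x).source

/-- The surface read in the preferred chart at `x`; only meaningful on `chartDomain f x`. -/
def inChart (f : M → CP3) (x : CP3) (q : M) : C3 := chartAt C3 x (f q)

theorem chartAt_symm_inChart {x : CP3} {q : M} (hq : q ∈ chartDomain f x) :
    (chartAt C3 x).symm (inChart f x q) = f q :=
  (chartAt C3 x).left_inv hq

variable [TopologicalSpace M] [ChartedSpace E2 M]

/-- The differential of the surface read in the preferred chart at `x`. -/
def dInChart (f : M → CP3) (x : CP3) (q : M) (w : TangentSpace 𝓘(ℝ, E2) q) : C3 :=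
  mfderiv 𝓘(ℝ, E2) 𝓘(ℝ, C3) (inChart f x) q w

theorem isOpen_chartDomain (hf : IsTotallyReal f) (x : CP3) : IsOpen (chartDomain f x) :=
  (chartAt C3 x).open_source.preimage hf.smooth.continuous

theorem smoothMapOn_inChart (hf : IsTotallyReal f) (x : CP3) :
    SmoothMapOn (chartDomain f x) (inChart f x) :=
  (contMDiffOn_chart (I := 𝓘(ℝ, C3)) (x := x)).comp hf.smooth.contMDiffOn fun _ h => h

theorem mdifferentiableAt_inChart (hf : IsTotallyReal f) {x : CP3} {q : M}
    (hq : q ∈ chartDomain f x) : MDifferentiableAt 𝓘(ℝ, E2) 𝓘(ℝ, C3) (inChart f x) q :=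
  (ContMDiffOn.contMDiffAt (smoothMapOn_inChart hf x)
    ((isOpen_chartDomain hf x).mem_nhds hq)).mdifferentiableAt (by simp)

theorem push_ne_zero (hf : IsTotallyReal f) {q : M} {w : TangentSpace 𝓘(ℝ, E2) q} (hw : w ≠ 0) :
    push f q w ≠ 0 := fun h =>
  hw (hf.immersion q (h.trans (map_zero (mfderiv 𝓘(ℝ, E2) 𝓘(ℝ, C3) f q)).symm))

theorem push_eq_dParam (hf : IsTotallyReal f) {x : CP3} {q : M} (hq : q ∈ chartDomain f x)
    (w : TangentSpace 𝓘(ℝ, E2) q) :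
    (push f q w : C3) = dParam x (inChart f x q) (dInChart f x q w) := by
  have chain := (hasMFDerivAt_dParam x (inChart f x q)).comp q
    (mdifferentiableAt_inChart hf hq).hasMFDerivAt
  have eventually_eq : f =ᶠ[𝓝 q] (chartAt C3 x).symm ∘ inChart f x := by
    filter_upwards [(isOpen_chartDomain hf x).mem_nhds hq] with q' hq'
    exact (chartAt_symm_inChart hq').symm
  rw [push, (chain.congr_of_eventuallyEq eventually_eq).mfderiv]
  rfl

theorem nkMetric_push (hf : IsTotallyReal f) {x : CP3} {q : M} (hq : q ∈ chartDomain f x)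
    (v w : TangentSpace 𝓘(ℝ, E2) q) : nkMetric (f q) (push f q v) (push f q w) =
      metricInChart x (inChart f x q) (dInChart f x q v) (dInChart f x q w) := by
  rw [push_eq_dParam hf hq v, push_eq_dParam hf hq w, ← chartAt_symm_inChart hq]
  rfl

variable [IsManifold 𝓘(ℝ, E2) ∞ M] {N : Set M} {u v : ∀ q : M, TangentSpace 𝓘(ℝ, E2) q}

namespace SmoothFieldOn

theorem mono {N' : Set M} (hu : SmoothFieldOn N u) (h : N' ⊆ N) : SmoothFieldOn N' u :=
  ContMDiffOn.mono hu h

theorem add (hu : SmoothFieldOn N u) (hv : SmoothFieldOn N v) :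
    SmoothFieldOn N (fun q => u q + v q) :=
  ContMDiffOn.add_section hu hv

theorem sub (hu : SmoothFieldOn N u) (hv : SmoothFieldOn N v) :
    SmoothFieldOn N (fun q => u q - v q) :=
  ContMDiffOn.sub_section hu hv

theorem neg (hu : SmoothFieldOn N u) : SmoothFieldOn N (fun q => -u q) :=
  ContMDiffOn.neg_section hu

theorem smul {a : M → ℝ} (ha : SmoothMapOn N a) (hu : SmoothFieldOn N u) :
    SmoothFieldOn N (fun q => a q • u q) :=
  ContMDiffOn.smul_section ha hu

theorem dInChart (hf : IsTotallyReal f) {x : CP3} (hN : N ⊆ chartDomain f x)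
    (hu : SmoothFieldOn N u) : SmoothMapOn N (fun q => dInChart f x q (u q)) := by
  have isOpen := isOpen_chartDomain hf x
  have tangentMap := ContMDiffOn.contMDiffOn_tangentMapWithin (m := ∞) (smoothMapOn_inChart hf x)
    (by simp) isOpen.uniqueMDiffOn
  refine ((contMDiff_snd_tangentBundle_modelSpace C3 𝓘(ℝ, C3)).comp_contMDiffOn
    (tangentMap.comp hu hN)).congr fun q hq => ?_
  change _ = mfderivWithin 𝓘(ℝ, E2) 𝓘(ℝ, C3) (inChart f x) (chartDomain f x) q (u q)
  rw [mfderivWithin_of_isOpen isOpen (hN hq), CP3.dInChart]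

theorem nkMetric (hf : IsTotallyReal f) {x : CP3} (hN : N ⊆ chartDomain f x)
    (hu : SmoothFieldOn N u) (hv : SmoothFieldOn N v) :
    SmoothMapOn N (fun q => nkMetric (f q) (push f q (u q)) (push f q (v q))) := by
  have metric := ((smoothMapOn_inChart hf x).mono hN).contDiff_comp (contDiff_metricInChart x)
  exact (ContMDiffOn.clm_apply (ContMDiffOn.clm_apply metric (hu.dInChart hf hN))
    (hv.dInChart hf hN)).congr fun q hq => nkMetric_push hf (hN hq) _ _

end SmoothFieldOn

end InChart

/-! ### Orthonormal frames -/

section OrthonormalFields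

variable {M : Type*} [TopologicalSpace M] [ChartedSpace E2 M] [IsManifold 𝓘(ℝ, E2) ∞ M]
  {f : M → CP3}

theorem exists_local_fields (q₀ : M) : ∃ (N : Set M) (u v : ∀ q : M, TangentSpace 𝓘(ℝ, E2) q),
    IsOpen N ∧ q₀ ∈ N ∧ SmoothFieldOn N u ∧ SmoothFieldOn N v ∧
      ∀ q ∈ N, LinearIndependent ℝ ![u q, v q] := by
  let e := trivializationAt E2 (TangentSpace 𝓘(ℝ, E2) : M → Type _) q₀
  let b : Module.Basis (Fin 2) ℝ E2 := (EuclideanSpace.basisFun (Fin 2) ℝ).toBasis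
  have frame := e.isLocalFrameOn_localFrame_baseSet 𝓘(ℝ, E2) ∞ b
  refine ⟨e.baseSet, e.localFrame b 0, e.localFrame b 1, e.open_baseSet,
    FiberBundle.mem_baseSet_trivializationAt' q₀, frame.contMDiffOn 0, frame.contMDiffOn 1,
    fun q hq => ?_⟩
  have vec_eq : ![e.localFrame b 0 q, e.localFrame b 1 q] = fun i => e.localFrame b i q := by
    ext1 i
    fin_cases i <;> rfl
  rw [vec_eq]
  exact frame.linearIndependent hq

theorem SmoothFieldOn.exists_unit_smul (hf : IsTotallyReal f) {x : CP3} {N : Set M}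
    (hN : N ⊆ chartDomain f x) {w : ∀ q : M, TangentSpace 𝓘(ℝ, E2) q} (hw : SmoothFieldOn N w)
    (hne : ∀ q ∈ N, w q ≠ 0) : ∃ a : M → ℝ, SmoothMapOn N a ∧
      ∀ q ∈ N, CP3.nkMetric (f q) (push f q (a q • w q)) (push f q (a q • w q)) = 1 := by
  have pos : ∀ q ∈ N, 0 < CP3.nkMetric (f q) (push f q (w q)) (push f q (w q)) := fun q hq =>
    nkMetric_self_pos _ (push_ne_zero hf (hne q hq))
  refine ⟨fun q => 1 / √(CP3.nkMetric (f q) (push f q (w q)) (push f q (w q))),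
    (SmoothMapOn.const 1).div ((hw.nkMetric hf hN hw).sqrt fun q hq => (pos q hq).ne')
      fun q hq => (Real.sqrt_pos.2 (pos q hq)).ne', fun q hq => ?_⟩
  simp only [push_smul, map_smul, smul_apply, smul_eq_mul]
  rw [← mul_assoc, div_mul_div_comm, Real.mul_self_sqrt (pos q hq).le, mul_one,
    one_div_mul_cancel (pos q hq).ne']

theorem SmoothFieldOn.exists_orthonormal (hf : IsTotallyReal f) {x : CP3} {N : Set M}
    (hN : N ⊆ chartDomain f x) {u₀ v₀ : ∀ q : M, TangentSpace 𝓘(ℝ, E2) q}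
    (hu₀ : SmoothFieldOn N u₀) (hv₀ : SmoothFieldOn N v₀)
    (independent : ∀ q ∈ N, LinearIndependent ℝ ![u₀ q, v₀ q]) :
    ∃ u v : ∀ q : M, TangentSpace 𝓘(ℝ, E2) q, SmoothFieldOn N u ∧ SmoothFieldOn N v ∧
      ∀ q ∈ N, IsOrthonormalPair (f q) (push f q (u q)) (push f q (v q)) := by
  obtain ⟨a, smooth_a, unit_u⟩ := hu₀.exists_unit_smul hf hN
    fun q hq => (independent q hq).ne_zero 0
  let u := fun q => a q • u₀ q
  have smooth_u : SmoothFieldOn N u := hu₀.smul smooth_a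
  let g := fun q => CP3.nkMetric (f q) (push f q (u q)) (push f q (v₀ q))
  let w := fun q => v₀ q - g q • u q
  have smooth_w : SmoothFieldOn N w := hv₀.sub (smooth_u.smul (smooth_u.nkMetric hf hN hv₀))
  obtain ⟨d, smooth_d, unit_v⟩ := smooth_w.exists_unit_smul hf hN fun q hq hw => by
    have relation : (-(g q * a q)) • u₀ q + (1 : ℝ) • v₀ q = 0 := by
      rw [← hw]
      module
    exact one_ne_zero (LinearIndependent.pair_iff.1 (independent q hq) _ _ relation).2
  refine ⟨u, fun q => d q • w q, smooth_u, smooth_w.smul smooth_d,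
    fun q hq => ⟨unit_u q hq, unit_v q hq, ?_⟩⟩
  have push_w : push f q (w q) = push f q (v₀ q) - g q • push f q (u q) :=
    (map_sub (mfderiv 𝓘(ℝ, E2) 𝓘(ℝ, C3) f q) _ _).trans
      (congrArg (push f q (v₀ q) - ·) (push_smul (g q) (u q)))
  have unit : CP3.nkMetric (f q) (push f q (u q)) (push f q (u q)) = 1 := unit_u q hq
  change CP3.nkMetric (f q) (push f q (u q)) (push f q (d q • w q)) = 0
  rw [push_smul (d q) (w q), push_w, map_smul, map_sub, map_smul, unit, smul_eq_mul, smul_eq_mul,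
    mul_one, sub_self, mul_zero]

theorem exists_orthonormal_fields (hf : IsTotallyReal f) (q₀ : M) :
    ∃ N ⊆ chartDomain f (f q₀), IsOpen N ∧ q₀ ∈ N ∧ ∃ u v : ∀ q : M, TangentSpace 𝓘(ℝ, E2) q,
      SmoothFieldOn N u ∧ SmoothFieldOn N v ∧
        ∀ q ∈ N, IsOrthonormalPair (f q) (push f q (u q)) (push f q (v q)) := by
  obtain ⟨N, u, v, isOpen, mem, smooth_u, smooth_v, independent⟩ := exists_local_fields q₀
  exact ⟨N ∩ chartDomain f (f q₀), Set.inter_subset_right, isOpen.inter (isOpen_chartDomain hf _),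
    ⟨mem, mem_chart_source C3 (f q₀)⟩, SmoothFieldOn.exists_orthonormal hf Set.inter_subset_right
      (smooth_u.mono Set.inter_subset_left) (smooth_v.mono Set.inter_subset_left)
      fun q hq => independent q hq.1⟩

end OrthonormalFields

/-! ### Frames with smooth components -/

section IsSmoothFrame

variable {M : Type*} [TopologicalSpace M] [ChartedSpace E2 M] {f : M → CP3}

/-- `area` in a preferred chart: by `area_dParam` it gives the area of the images of `v` and `w`
under `dParam x y`, up to a factor that depends on the chart. -/
def chartArea (y v w : C3) : ℂ :=
  area v w - (⟪y, v⟫_ℂ * contact y w - contact y v * ⟪y, w⟫_ℂ) / ((1 + ‖y‖ ^ 2 : ℝ) : ℂ)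

namespace SmoothMapOn

variable {N : Set M} {y v w : M → C3}

theorem one_add_norm_sq (hy : SmoothMapOn N y) :
    SmoothMapOn N (fun q => ((1 + ‖y q‖ ^ 2 : ℝ) : ℂ)) :=
  (hy.contDiff_comp (contDiff_const.add (contDiff_id.norm_sq ℝ))).ofReal

theorem contact (hy : SmoothMapOn N y) (hv : SmoothMapOn N v) :
    SmoothMapOn N (fun q => contact (y q) (v q)) := by
  refine (hy.prodMk hv).contDiff_comp (φ := fun z => CP3.contact z.1 z.2) ?_
  unfold CP3.contact
  fun_prop

theorem chartArea (hy : SmoothMapOn N y) (hv : SmoothMapOn N v) (hw : SmoothMapOn N w) :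
    SmoothMapOn N (fun q => chartArea (y q) (v q) (w q)) := by
  have area : SmoothMapOn N (fun q => area (v q) (w q)) := by
    refine (hv.prodMk hw).contDiff_comp (φ := fun z => CP3.area z.1 z.2) ?_
    unfold CP3.area
    fun_prop
  have inner {u : M → C3} (hu : SmoothMapOn N u) : SmoothMapOn N (fun q => ⟪y q, u q⟫_ℂ) :=
    (hy.prodMk hu).contDiff_comp (contDiff_fst.inner ℂ contDiff_snd)
  exact area.sub ((((inner hv).mul (hy.contact hw)).sub ((hy.contact hv).mul (inner hw))).div
    hy.one_add_norm_sq fun q _ => Complex.ofReal_ne_zero.2 (by positivity))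

end SmoothMapOn

theorem exists_phase_div_transitionFactor_sq (x : CP3) (y : C3) : ∃ e : ℂ, e * star e = 1 ∧
    ∀ z : ℂ, z / transitionFactor x y ^ 2 = e * (z / ((1 + ‖y‖ ^ 2 : ℝ) : ℂ)) := by
  have factor_ne := transitionFactor_ne_zero x y
  have star_ne : star (transitionFactor x y) ≠ 0 := star_ne_zero.2 factor_ne
  refine ⟨star (transitionFactor x y) / transitionFactor x y, ?_, fun z => ?_⟩
  · rw [star_div₀, star_star]
    field_simp
  · rw [← transitionFactor_mul_star x y]
    field_simp

variable [IsManifold 𝓘(ℝ, E2) ∞ M]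

/-- A smooth orthonormal frame `u`, `v` on the open set `N`, and smooth functions `a`, `b`, `c` that
are its components in the sense of `HasComponents`. The common phase need not be smooth. -/
structure IsSmoothFrame (f : M → CP3) (N : Set M) (u v : ∀ q : M, TangentSpace 𝓘(ℝ, E2) q)
    (a b c : M → ℂ) : Prop where
  isOpen : IsOpen N
  smooth_left : SmoothFieldOn N u
  smooth_right : SmoothFieldOn N v
  smooth_a : SmoothMapOn N a
  smooth_b : SmoothMapOn N b
  smooth_c : SmoothMapOn N c
  hasComponents : ∀ q ∈ N,
    HasComponents (f q) (push f q (u q)) (push f q (v q)) (a q) (b q) (c q)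

theorem isSmoothFrame_of_isOrthonormalPair (hf : IsTotallyReal f) {x : CP3} {N : Set M}
    (hN : N ⊆ chartDomain f x) (isOpen : IsOpen N) {u v : ∀ q : M, TangentSpace 𝓘(ℝ, E2) q}
    (hu : SmoothFieldOn N u) (hv : SmoothFieldOn N v)
    (orthonormal : ∀ q ∈ N, IsOrthonormalPair (f q) (push f q (u q)) (push f q (v q))) :
    ∃ a b c : M → ℂ, IsSmoothFrame f N u v a b c := by
  let y := inChart f x
  let dv := fun q => dInChart f x q (v q)
  let du := fun q => dInChart f x q (u q)
  have smooth_y : SmoothMapOn N y := (smoothMapOn_inChart hf x).mono hN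
  have smooth_du : SmoothMapOn N du := hu.dInChart hf hN
  have smooth_dv : SmoothMapOn N dv := hv.dInChart hf hN
  have smooth_div {z : M → ℂ} (hz : SmoothMapOn N z) :
      SmoothMapOn N (fun q => z q / ((1 + ‖y q‖ ^ 2 : ℝ) : ℂ)) :=
    hz.div smooth_y.one_add_norm_sq fun q _ => Complex.ofReal_ne_zero.2 (by positivity)
  refine ⟨_, _, _, isOpen, hu, hv, smooth_div (smooth_y.contact smooth_du),
    smooth_div (smooth_y.contact smooth_dv),
    smooth_div ((SmoothMapOn.const (-(2 * Complex.I))).mul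
      (smooth_y.chartArea smooth_du smooth_dv)), fun q hq => ?_⟩
  obtain ⟨e, he, div_eq⟩ := exists_phase_div_transitionFactor_sq x (y q)
  have push_u := push_eq_dParam hf (hN hq) (u q)
  have push_v := push_eq_dParam hf (hN hq) (v q)
  refine ⟨hf.isUnitaryPair (orthonormal q hq), e, he, ?_, ?_, ?_⟩
  · rw [push_u, dParam_apply_zero, div_eq]
  · rw [push_v, dParam_apply_zero, div_eq]
  · rw [G_apply, push_u, push_v, ← div_eq, mul_div_assoc, chartArea, ← area_dParam]
    simp
    ring

theorem exists_isSmoothFrame (hf : IsTotallyReal f) (q₀ : M) :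
    ∃ (N : Set M) (u v : ∀ q : M, TangentSpace 𝓘(ℝ, E2) q) (a b c : M → ℂ),
      q₀ ∈ N ∧ IsSmoothFrame f N u v a b c := by
  obtain ⟨N, hN, isOpen, mem, u, v, hu, hv, orthonormal⟩ := exists_orthonormal_fields hf q₀
  obtain ⟨a, b, c, frame⟩ := isSmoothFrame_of_isOrthonormalPair hf hN isOpen hu hv orthonormal
  exact ⟨N, u, v, a, b, c, mem, frame⟩

end IsSmoothFrame

/-! ### No open piece of the surface is tangent to the contact distribution -/

theorem area_fderiv_eq_zero {E : Type*} [NormedAddCommGroup E] [NormedSpace ℝ E] {h : E → C3}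
    {z : E} (hh : ContDiffAt ℝ 2 h z)
    (legendrian : ∀ᶠ z' in 𝓝 z, ∀ e, contact (h z') (fderiv ℝ h z' e) = 0) (e e' : E) :
    area (fderiv ℝ h z e) (fderiv ℝ h z e') = 0 := by
  let D := fderiv ℝ h
  let S := fderiv ℝ D z
  let coord (i : Fin 3) : C3 →L[ℝ] ℂ := (EuclideanSpace.proj i : C3 →L[ℂ] ℂ).restrictScalars ℝ
  have hasFDerivAt_D : HasFDerivAt D S z :=
    ((hh.fderiv_right (m := 1) (by norm_num)).differentiableAt (by simp)).hasFDerivAt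
  have hasFDerivAt_h (i : Fin 3) : HasFDerivAt (fun z => h z i) (coord i ∘L D z) z :=
    (coord i).hasFDerivAt.comp z (hh.differentiableAt (by simp)).hasFDerivAt
  have hasFDerivAt_D_apply (v : E) (i : Fin 3) :
      HasFDerivAt (fun z => D z v i) (coord i ∘L S.flip v) z := by
    have apply_v : HasFDerivAt (fun z => D z v) (S.flip v) z := by
      simpa using hasFDerivAt_D.clm_apply (hasFDerivAt_const v z)
    exact (coord i).hasFDerivAt.comp z apply_v
  have derivative (v w : E) :
      contact (h z) (S w v) - D z w 2 * D z v 1 + D z w 1 * D z v 2 = 0 := by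
    have zero : (fun z => contact (h z) (D z v)) =ᶠ[𝓝 z] fun _ => 0 :=
      legendrian.mono fun z' hz' => hz' v
    have product := ((hasFDerivAt_D_apply v 0).sub ((hasFDerivAt_h 2).mul
      (hasFDerivAt_D_apply v 1))).add ((hasFDerivAt_h 1).mul (hasFDerivAt_D_apply v 2))
    have at_w := DFunLike.congr_fun
      (product.unique ((hasFDerivAt_const (0 : ℂ) z).congr_of_eventuallyEq zero)) w
    simp [coord] at at_w
    rw [contact]
    linear_combination at_w
  have symmetric : S e e' = S e' e := hh.isSymmSndFDerivAt (by simp) e e'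
  have derivative_swap := derivative e' e
  rw [symmetric] at derivative_swap
  rw [area]
  linear_combination (derivative_swap - derivative e e') / 2

section Legendrian

variable {M : Type*} [TopologicalSpace M] [ChartedSpace E2 M] [IsManifold 𝓘(ℝ, E2) ∞ M]

theorem area_mfderiv_eq_zero {g : M → C3} {S : Set M} (hS : IsOpen S) (hg : SmoothMapOn S g)
    (legendrian : ∀ q ∈ S, ∀ w, contact (g q) (mfderiv 𝓘(ℝ, E2) 𝓘(ℝ, C3) g q w) = 0) {q₀ : M}
    (hq₀ : q₀ ∈ S) (w w' : TangentSpace 𝓘(ℝ, E2) q₀) :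
    area (mfderiv 𝓘(ℝ, E2) 𝓘(ℝ, C3) g q₀ w) (mfderiv 𝓘(ℝ, E2) 𝓘(ℝ, C3) g q₀ w') = 0 := by
  let φ := chartAt E2 q₀
  let Z : Set E2 := φ.target ∩ φ.symm ⁻¹' S
  have mdifferentiableAt_g {q : M} (hq : q ∈ S) : MDifferentiableAt 𝓘(ℝ, E2) 𝓘(ℝ, C3) g q :=
    (ContMDiffOn.contMDiffAt hg (hS.mem_nhds hq)).mdifferentiableAt (by simp)
  have smooth_symm : ContMDiffOn 𝓘(ℝ, E2) 𝓘(ℝ, E2) ∞ φ.symm φ.target := contMDiffOn_chart_symm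
  have symm_φ : φ.symm (φ q₀) = q₀ := φ.left_inv (mem_chart_source E2 q₀)
  have isOpen_Z : IsOpen Z := φ.symm.isOpen_inter_preimage hS
  have mem_Z : φ q₀ ∈ Z :=
    ⟨φ.map_source (mem_chart_source E2 q₀), by rwa [Set.mem_preimage, symm_φ]⟩
  have smooth : ContDiffOn ℝ ∞ (g ∘ φ.symm) Z := by
    rw [← contMDiffOn_iff_contDiffOn]
    exact ContMDiffOn.comp hg (smooth_symm.mono Set.inter_subset_left) fun z hz => hz.2
  have chain {z : E2} (hz : z ∈ Z) (e : E2) : fderiv ℝ (g ∘ φ.symm) z e =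
      mfderiv 𝓘(ℝ, E2) 𝓘(ℝ, C3) g (φ.symm z) (mfderiv 𝓘(ℝ, E2) 𝓘(ℝ, E2) φ.symm z e) := by
    have mdifferentiableAt_symm : MDifferentiableAt 𝓘(ℝ, E2) 𝓘(ℝ, E2) φ.symm z :=
      (smooth_symm.contMDiffAt (φ.open_target.mem_nhds hz.1)).mdifferentiableAt (by simp)
    rw [← mfderiv_eq_fderiv, mfderiv_comp z (mdifferentiableAt_g hz.2) mdifferentiableAt_symm]
    rfl
  have mfderiv_eq (w : TangentSpace 𝓘(ℝ, E2) q₀) :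
      mfderiv 𝓘(ℝ, E2) 𝓘(ℝ, C3) g q₀ w = fderiv ℝ (g ∘ φ.symm) (φ q₀) w := by
    rw [(mdifferentiableAt_g hq₀).mfderiv, ← fderivWithin_univ]
    simp [writtenInExtChartAt, φ]
    rfl
  rw [mfderiv_eq, mfderiv_eq]
  refine area_fderiv_eq_zero ((smooth.contDiffAt (isOpen_Z.mem_nhds mem_Z)).of_le
    (WithTop.coe_le_coe.2 (le_top : (2 : ℕ∞) ≤ ⊤)))
    (Filter.eventually_of_mem (isOpen_Z.mem_nhds mem_Z) fun z hz e => ?_) w w'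
  rw [chain hz]
  exact legendrian _ hz.2 _

variable {f : M → CP3}

theorem IsTotallyReal.exists_push_apply_zero_ne_zero (hf : IsTotallyReal f) {N : Set M}
    (isOpen : IsOpen N) (nonempty : N.Nonempty) : ∃ q ∈ N, ∃ w, push f q w 0 ≠ 0 := by
  by_contra! push_zero
  obtain ⟨q₀, hq₀⟩ := nonempty
  let x := f q₀
  have mem : q₀ ∈ chartDomain f x := mem_chart_source C3 x
  have legendrian : ∀ q ∈ N ∩ chartDomain f x, ∀ w,
      contact (inChart f x q) (dInChart f x q w) = 0 := fun q hq w => by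
    have zero := push_zero q hq.1 w
    rw [push_eq_dParam hf hq.2, dParam_apply_zero] at zero
    exact (div_eq_zero_iff.1 zero).resolve_right (pow_ne_zero 2 (transitionFactor_ne_zero _ _))
  have area_push (v w : TangentSpace 𝓘(ℝ, E2) q₀) : area (push f q₀ v) (push f q₀ w) = 0 := by
    have area_dInChart : area (dInChart f x q₀ v) (dInChart f x q₀ w) = 0 :=
      area_mfderiv_eq_zero (isOpen.inter (isOpen_chartDomain hf x))
        ((smoothMapOn_inChart hf x).mono Set.inter_subset_right) legendrian ⟨hq₀, mem⟩ v w
    rw [push_eq_dParam hf mem, push_eq_dParam hf mem, area_dParam, area_dInChart,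
      legendrian q₀ ⟨hq₀, mem⟩, legendrian q₀ ⟨hq₀, mem⟩]
    simp
  obtain ⟨O, -, -, mem_O, u, v, -, -, orthonormal⟩ := exists_orthonormal_fields hf q₀
  have unit := (hf.isUnitaryPair (orthonormal q₀ mem_O)).first_column
  rw [push_zero q₀ hq₀, push_zero q₀ hq₀, G_apply] at unit
  simp [area_push] at unit

theorem IsSmoothFrame.exists_ne_zero (hf : IsTotallyReal f) {N : Set M}
    {u v : ∀ q : M, TangentSpace 𝓘(ℝ, E2) q} {a b c : M → ℂ} (h : IsSmoothFrame f N u v a b c)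
    (nonempty : N.Nonempty) : ∃ q ∈ N, a q ≠ 0 ∨ b q ≠ 0 := by
  obtain ⟨q, hq, w, hw⟩ := hf.exists_push_apply_zero_ne_zero h.isOpen nonempty
  refine ⟨q, hq, ?_⟩
  by_contra! zero
  obtain ⟨pair, e, -, hu, hv, -⟩ := h.hasComponents q hq
  obtain ⟨p, r, combination⟩ := exists_combination pair.isOrthonormalPair w
  rw [zero.1, mul_zero] at hu
  rw [zero.2, mul_zero] at hv
  simp [combination, hu, hv] at hw

end Legendrian

/-! ### Reduction to the axes of an ellipse -/

theorem star_div_norm_mul_self {s : ℂ} (hs : s ≠ 0) : star s / ‖s‖ * s = ‖s‖ := by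
  have norm_ne : (‖s‖ : ℂ) ≠ 0 := Complex.ofReal_ne_zero.2 (norm_ne_zero_iff.2 hs)
  rw [div_mul_eq_mul_div, Complex.star_def, Complex.conj_mul', sq, mul_div_cancel_right₀ _ norm_ne]

theorem star_div_norm_mul_star {s : ℂ} (hs : s ≠ 0) :
    star s / ‖s‖ * star (star s / ‖s‖) = 1 := by
  have norm_ne : (‖s‖ : ℂ) ≠ 0 := Complex.ofReal_ne_zero.2 (norm_ne_zero_iff.2 hs)
  have star_norm : star (‖s‖ : ℂ) = ‖s‖ := Complex.conj_ofReal _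
  rw [star_div₀, star_star, star_norm, ← mul_div_assoc, star_div_norm_mul_self hs,
    div_self norm_ne]

theorem re_sq_add_sq_le (a b : ℂ) : (a ^ 2 + b ^ 2).re ≤ a.re ^ 2 + b.re ^ 2 := by
  rw [sq a, sq b, Complex.add_re, Complex.mul_re, Complex.mul_re]
  linarith [mul_self_nonneg a.im, mul_self_nonneg b.im]

theorem re_rotate_eq_ofReal {a b : ℂ} {R : ℝ} (hR : R ≠ 0) (sq_eq : R ^ 2 = a.re ^ 2 + b.re ^ 2)
    (im_eq_zero : (a ^ 2 + b ^ 2).im = 0) :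
    ((a.re / R : ℝ) : ℂ) * a + ((b.re / R : ℝ) : ℂ) * b = R := by
  simp only [sq, Complex.add_im, Complex.mul_im] at im_eq_zero
  refine Complex.ext ?_ ?_
  · simp only [Complex.add_re, Complex.re_ofReal_mul, Complex.ofReal_re]
    field_simp
    linarith
  · simp only [Complex.add_im, Complex.im_ofReal_mul, Complex.ofReal_im]
    field_simp
    linarith

theorem re_rotate_eq_I_mul (a b : ℂ) (R : ℝ) :
    -((b.re / R : ℝ) : ℂ) * a + ((a.re / R : ℝ) : ℂ) * b =
      Complex.I * ((a.re * b.im - b.re * a.im) / R : ℝ) := by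
  rw [← Complex.ofReal_neg]
  refine Complex.ext ?_ ?_
  · simp only [Complex.add_re, Complex.re_ofReal_mul, Complex.I_mul_re, Complex.ofReal_im]
    ring
  · simp only [Complex.add_im, Complex.im_ofReal_mul, Complex.I_mul_im, Complex.ofReal_re]
    ring

section Reduction

variable {M : Type*} [TopologicalSpace M] [ChartedSpace E2 M] [IsManifold 𝓘(ℝ, E2) ∞ M]
  {f : M → CP3} {N : Set M} {u v : ∀ q : M, TangentSpace 𝓘(ℝ, E2) q} {a b c : M → ℂ}

namespace IsSmoothFrame

theorem mono {N' : Set M} (h : IsSmoothFrame f N u v a b c) (isOpen : IsOpen N') (hs : N' ⊆ N) :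
    IsSmoothFrame f N' u v a b c :=
  ⟨isOpen, h.smooth_left.mono hs, h.smooth_right.mono hs, h.smooth_a.mono hs, h.smooth_b.mono hs,
    h.smooth_c.mono hs, fun q hq => h.hasComponents q (hs hq)⟩

theorem shrink {F : Type*} [NormedAddCommGroup F] [NormedSpace ℝ F] {g : M → F} {s : Set F}
    (h : IsSmoothFrame f N u v a b c) (hg : SmoothMapOn N g) (hs : IsOpen s) :
    IsSmoothFrame f (N ∩ g ⁻¹' s) u v a b c :=
  h.mono (hg.isOpen_inter_preimage h.isOpen hs) Set.inter_subset_left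

theorem congr {a' b' c' : M → ℂ} (h : IsSmoothFrame f N u v a b c) (ha : ∀ q ∈ N, a' q = a q)
    (hb : ∀ q ∈ N, b' q = b q) (hc : ∀ q ∈ N, c' q = c q) : IsSmoothFrame f N u v a' b' c' :=
  ⟨h.isOpen, h.smooth_left, h.smooth_right, ContMDiffOn.congr h.smooth_a ha,
    ContMDiffOn.congr h.smooth_b hb, ContMDiffOn.congr h.smooth_c hc, fun q hq => by
      rw [ha q hq, hb q hq, hc q hq]
      exact h.hasComponents q hq⟩

theorem mul_star_phase (h : IsSmoothFrame f N u v a b c) {s : M → ℂ} (hs : SmoothMapOn N s)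
    (hne : ∀ q ∈ N, s q ≠ 0) :
    IsSmoothFrame f N u v (fun q => star (s q) / ‖s q‖ * a q) (fun q => star (s q) / ‖s q‖ * b q)
      (fun q => star (s q) / ‖s q‖ * c q) :=
  have smooth_phase : SmoothMapOn N (fun q => star (s q) / (‖s q‖ : ℂ)) :=
    hs.star.div (hs.norm hne).ofReal fun q hq =>
      Complex.ofReal_ne_zero.2 (norm_ne_zero_iff.2 (hne q hq))
  ⟨h.isOpen, h.smooth_left, h.smooth_right, smooth_phase.mul h.smooth_a,
    smooth_phase.mul h.smooth_b, smooth_phase.mul h.smooth_c,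
    fun q hq => (h.hasComponents q hq).mul_phase (star_div_norm_mul_star (hne q hq))⟩

theorem rotate (h : IsSmoothFrame f N u v a b c) {p r : M → ℝ} (hp : SmoothMapOn N p)
    (hr : SmoothMapOn N r) (hpr : ∀ q ∈ N, p q ^ 2 + r q ^ 2 = 1) :
    IsSmoothFrame f N (fun q => p q • u q + r q • v q) (fun q => -r q • u q + p q • v q)
      (fun q => p q * a q + r q * b q) (fun q => -r q * a q + p q * b q) c :=
  ⟨h.isOpen, (h.smooth_left.smul hp).add (h.smooth_right.smul hr),
    (h.smooth_left.smul hr.neg).add (h.smooth_right.smul hp),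
    (hp.ofReal.mul h.smooth_a).add (hr.ofReal.mul h.smooth_b),
    (hr.ofReal.neg.mul h.smooth_a).add (hp.ofReal.mul h.smooth_b), h.smooth_c, fun q hq => by
      simp only [push_add, push_smul]
      exact (h.hasComponents q hq).rotate (hpr q hq)⟩

theorem reflect (h : IsSmoothFrame f N u v a b c) :
    IsSmoothFrame f N u (fun q => -v q) a (fun q => -b q) (fun q => -c q) :=
  ⟨h.isOpen, h.smooth_left, h.smooth_right.neg, h.smooth_a, h.smooth_b.neg, h.smooth_c.neg,
    fun q hq => by
      have push_neg : push f q (-v q) = -push f q (v q) :=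
        map_neg (mfderiv 𝓘(ℝ, E2) 𝓘(ℝ, C3) f q) (v q)
      rw [push_neg]
      exact (h.hasComponents q hq).reflect⟩

end IsSmoothFrame

/-- A smooth frame for which the components `r`, `I * t` of `u`, `v` lie on the axes of the ellipse
that the components of the unit tangent vectors trace out. Up to the phase, every frame can locally
be rotated into this form, and the normal forms can be read off from it. -/
structure IsReduced (f : M → CP3) (N : Set M) (u v : ∀ q : M, TangentSpace 𝓘(ℝ, E2) q)
    (r t : M → ℝ) (c : M → ℂ) : Prop where
  isSmoothFrame : IsSmoothFrame f N u v (fun q => r q) (fun q => Complex.I * t q) c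
  pos : ∀ q ∈ N, 0 < r q

namespace IsSmoothFrame

theorem exists_isReduced_of_im_eq_zero (h : IsSmoothFrame f N u v a b c)
    (im_eq_zero : ∀ q ∈ N, (a q ^ 2 + b q ^ 2).im = 0)
    (pos : ∀ q ∈ N, 0 < (a q).re ^ 2 + (b q).re ^ 2) :
    ∃ u v r t c, IsReduced f N u v r t c := by
  let R : M → ℝ := fun q => √((a q).re ^ 2 + (b q).re ^ 2)
  have R_pos : ∀ q ∈ N, 0 < R q := fun q hq => Real.sqrt_pos.2 (pos q hq)
  have R_ne : ∀ q ∈ N, R q ≠ 0 := fun q hq => (R_pos q hq).ne'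
  have R_sq : ∀ q ∈ N, R q ^ 2 = (a q).re ^ 2 + (b q).re ^ 2 := fun q hq =>
    Real.sq_sqrt (pos q hq).le
  have smooth_R : SmoothMapOn N R := by
    refine SmoothMapOn.sqrt ?_ fun q hq => (pos q hq).ne'
    simpa only [sq] using
      (h.smooth_a.re.mul h.smooth_a.re).add (h.smooth_b.re.mul h.smooth_b.re)
  have rotated := h.rotate (h.smooth_a.re.div smooth_R R_ne) (h.smooth_b.re.div smooth_R R_ne)
    fun q hq => by
      rw [div_pow, div_pow, ← add_div, ← R_sq q hq, div_self (pow_ne_zero 2 (R_ne q hq))]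
  exact ⟨_, _, R, _, c, rotated.congr
    (fun q hq => (re_rotate_eq_ofReal (R_ne q hq) (R_sq q hq) (im_eq_zero q hq)).symm)
    (fun q _ => (re_rotate_eq_I_mul (a q) (b q) (R q)).symm) fun _ _ => rfl, R_pos⟩

theorem exists_isReduced_of_eq_sq (h : IsSmoothFrame f N u v a b c) {s : M → ℂ}
    (hs : SmoothMapOn N s) (hne : ∀ q ∈ N, s q ≠ 0)
    (sq_eq : ∀ q ∈ N, a q ^ 2 + b q ^ 2 = s q ^ 2) :
    ∃ u v r t c, IsReduced f N u v r t c := by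
  have real_pos : ∀ q ∈ N, (star (s q) / ‖s q‖ * a q) ^ 2 + (star (s q) / ‖s q‖ * b q) ^ 2 =
      ((‖s q‖ ^ 2 : ℝ) : ℂ) := fun q hq => by
    rw [mul_pow, mul_pow, ← mul_add, sq_eq q hq, ← mul_pow, star_div_norm_mul_self (hne q hq),
      Complex.ofReal_pow]
  refine (h.mul_star_phase hs hne).exists_isReduced_of_im_eq_zero
    (fun q hq => by rw [real_pos q hq, Complex.ofReal_im]) fun q hq => ?_
  have norm_pos : 0 < ‖s q‖ ^ 2 := pow_pos (norm_pos_iff.2 (hne q hq)) 2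
  have re_eq := congrArg Complex.re (real_pos q hq)
  rw [Complex.ofReal_re] at re_eq
  exact (re_eq ▸ norm_pos).trans_le (re_sq_add_sq_le _ _)

theorem exists_isReduced_of_eq_zero (h : IsSmoothFrame f N u v a b c) (hne : ∀ q ∈ N, a q ≠ 0)
    (eq_zero : ∀ q ∈ N, a q ^ 2 + b q ^ 2 = 0) :
    ∃ u v r t c, IsReduced f N u v r t c := by
  refine (h.mul_star_phase h.smooth_a hne).exists_isReduced_of_im_eq_zero (fun q hq => ?_)
    fun q hq => ?_
  · rw [mul_pow, mul_pow, ← mul_add, eq_zero q hq, mul_zero, Complex.zero_im]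
  · rw [star_div_norm_mul_self (hne q hq), Complex.ofReal_re]
    have norm_pos : 0 < ‖a q‖ := norm_pos_iff.2 (hne q hq)
    positivity

theorem exists_isReduced (hf : IsTotallyReal f) (h : IsSmoothFrame f N u v a b c)
    (nonempty : N.Nonempty) :
    ∃ N' ⊆ N, N'.Nonempty ∧ ∃ u v r t c, IsReduced f N' u v r t c := by
  by_cases eq_zero : ∀ q ∈ N, a q ^ 2 + b q ^ 2 = 0
  · obtain ⟨q₁, hq₁, ne_zero⟩ := h.exists_ne_zero hf nonempty
    have a_ne : a q₁ ≠ 0 := fun ha => ne_zero.elim (· ha) fun hb => hb <| by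
      simpa [ha] using eq_zero q₁ hq₁
    exact ⟨_, Set.inter_subset_left, ⟨q₁, hq₁, a_ne⟩,
      (h.shrink h.smooth_a isOpen_compl_singleton).exists_isReduced_of_eq_zero (fun q hq => hq.2)
        fun q hq => eq_zero q hq.1⟩
  · push Not at eq_zero
    obtain ⟨q₁, hq₁, ne_zero⟩ := eq_zero
    have smooth : SmoothMapOn N (fun q => a q ^ 2 + b q ^ 2) := by
      simpa only [sq] using (h.smooth_a.mul h.smooth_a).add (h.smooth_b.mul h.smooth_b)
    obtain ⟨N', hN', isOpen, mem, w, smooth_w, exp_w⟩ :=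
      smooth.exists_local_log h.isOpen hq₁ ne_zero
    exact ⟨N', hN', ⟨q₁, mem⟩, (h.mono isOpen hN').exists_isReduced_of_eq_sq
      (s := fun q => Complex.exp (w q * (1 / 2)))
      ((smooth_w.mul (.const _)).contDiff_comp Complex.contDiff_exp)
      (fun q _ => Complex.exp_ne_zero _) fun q hq => by
        rw [← exp_w q hq, sq, ← Complex.exp_add, ← mul_add, add_halves, mul_one]⟩

end IsSmoothFrame

namespace IsReduced

variable {r t : M → ℝ}

theorem smooth_r (h : IsReduced f N u v r t c) : SmoothMapOn N r := h.isSmoothFrame.smooth_a.re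

theorem smooth_t (h : IsReduced f N u v r t c) : SmoothMapOn N t := by
  simpa only [Complex.I_mul_im, Complex.ofReal_re] using h.isSmoothFrame.smooth_b.im

theorem mono {N' : Set M} (h : IsReduced f N u v r t c) (isOpen : IsOpen N') (hs : N' ⊆ N) :
    IsReduced f N' u v r t c :=
  ⟨h.isSmoothFrame.mono isOpen hs, fun q hq => h.pos q (hs hq)⟩

theorem exists_nonneg (h : IsReduced f N u v r t c) (nonempty : N.Nonempty) :
    ∃ N' ⊆ N, N'.Nonempty ∧ ∃ v t c, IsReduced f N' u v r t c ∧ ∀ q ∈ N', 0 ≤ t q := by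
  by_cases nonneg : ∀ q ∈ N, 0 ≤ t q
  · exact ⟨N, subset_rfl, nonempty, v, t, c, h, nonneg⟩
  · push Not at nonneg
    obtain ⟨q₁, hq₁, neg⟩ := nonneg
    have reflected := (h.isSmoothFrame.shrink h.smooth_t (isOpen_Iio (a := 0))).reflect
    exact ⟨N ∩ t ⁻¹' Set.Iio 0, Set.inter_subset_left, ⟨q₁, hq₁, neg⟩, fun q => -v q,
      fun q => -t q, fun q => -c q, ⟨reflected.congr (fun _ _ => rfl)
        (fun _ _ => by rw [Complex.ofReal_neg, mul_neg]) fun _ _ => rfl, fun q hq => h.pos q hq.1⟩,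
      fun q hq => (neg_pos.2 hq.2).le⟩

end IsReduced

theorem exists_isReduced (hf : IsTotallyReal f) {O : Set M} (isOpen : IsOpen O)
    (nonempty : O.Nonempty) : ∃ N ⊆ O, N.Nonempty ∧
      ∃ u v r t c, IsReduced f N u v r t c ∧ ∀ q ∈ N, 0 ≤ t q := by
  obtain ⟨q₀, hq₀⟩ := nonempty
  obtain ⟨N₀, u₀, v₀, a, b, c₀, mem, frame⟩ := exists_isSmoothFrame hf q₀
  obtain ⟨N₁, hN₁, nonempty₁, u, v₁, r, t₁, c₁, reduced⟩ :=
    (frame.mono (frame.isOpen.inter isOpen) Set.inter_subset_left).exists_isReduced hf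
      ⟨q₀, mem, hq₀⟩
  obtain ⟨N, hN, nonempty, v, t, c, reduced, nonneg⟩ := reduced.exists_nonneg nonempty₁
  exact ⟨N, (hN.trans hN₁).trans Set.inter_subset_right, nonempty, u, v, r, t, c, reduced, nonneg⟩

end Reduction

/-! ### The normal forms on open sets -/

theorem norm_mul_cos_and_sin_of_exp_eq {w c : ℂ} (h : Complex.exp w = -star c) :
    ‖c‖ * Real.cos w.im = -c.re ∧ ‖c‖ * Real.sin w.im = c.im := by
  have norm_eq : ‖c‖ = Real.exp w.re := by
    rw [← Complex.norm_exp, h, norm_neg, norm_star]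
  have re_eq := congrArg Complex.re h
  have im_eq := congrArg Complex.im h
  rw [Complex.exp_re, Complex.neg_re, Complex.star_def, Complex.conj_re] at re_eq
  rw [Complex.exp_im, Complex.neg_im, Complex.star_def, Complex.conj_im, neg_neg] at im_eq
  rw [norm_eq]
  exact ⟨re_eq, im_eq⟩

theorem re_div_norm_add_im_div_norm_mul_I (s : ℂ) :
    ((s.re / ‖s‖ : ℝ) : ℂ) + ((s.im / ‖s‖ : ℝ) : ℂ) * Complex.I = s / ‖s‖ := by
  rw [Complex.ofReal_div, Complex.ofReal_div, div_mul_eq_mul_div, ← add_div, Complex.re_add_im]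

theorem re_div_norm_sq_add_im_div_norm_sq {s : ℂ} (hs : s ≠ 0) :
    (s.re / ‖s‖) ^ 2 + (s.im / ‖s‖) ^ 2 = 1 := by
  rw [div_pow, div_pow, ← add_div, sq s.re, sq s.im, ← Complex.normSq_apply, Complex.sq_norm,
    div_self (Complex.normSq_pos.2 hs).ne']

theorem star_div_norm_mul_div_norm_mul {s : ℂ} (hs : s ≠ 0) (z : ℂ) :
    star s / ‖s‖ * (s / ‖s‖ * z) = z := by
  rw [← mul_assoc, ← mul_div_assoc, star_div_norm_mul_self hs,
    div_self (Complex.ofReal_ne_zero.2 (norm_ne_zero_iff.2 hs)), one_mul]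

section NormalForm

variable {M : Type*} [TopologicalSpace M] [ChartedSpace E2 M] [IsManifold 𝓘(ℝ, E2) ∞ M]
  {f : M → CP3} {N : Set M} {u v : ∀ q : M, TangentSpace 𝓘(ℝ, E2) q} {r t : M → ℝ} {c : M → ℂ}

/-- On `N` there is a smooth adapted frame in which `J_∘` has one of the three normal forms. -/
def HasNormalForm (f : M → CP3) (N : Set M) : Prop :=
  ∃ u v : ∀ q : M, TangentSpace 𝓘(ℝ, E2) q, SmoothFieldOn N u ∧ SmoothFieldOn N v ∧
    (∀ q ∈ N, IsAdaptedFrame (f q) (push f q (u q)) (push f q (v q))) ∧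
    (∀ q ∈ N, fsMetric (f q) (push f q (u q)) (push f q (v q)) = 0) ∧
    ((∃ l α θ : M → ℝ, SmoothFunOn N l ∧ SmoothFunOn N α ∧ SmoothFunOn N θ ∧
        ∀ q ∈ N, 0 ≤ l q ∧ Type0 (f q) (push f q (u q)) (push f q (v q)) (l q) (α q) (θ q)) ∨
      (∀ q ∈ N, Type1 (f q) (push f q (u q)) (push f q (v q))) ∨
      (∃ α : M → ℝ, SmoothFunOn N α ∧
        ∀ q ∈ N, 0 ≤ Real.cos (α q) ∧ Type2 (f q) (push f q (u q)) (push f q (v q)) (α q)))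

namespace IsReduced

theorem hasComponents (h : IsReduced f N u v r t c) {q : M} (hq : q ∈ N) :
    HasComponents (f q) (push f q (u q)) (push f q (v q)) (r q) (Complex.I * t q) (c q) :=
  h.isSmoothFrame.hasComponents q hq

theorem isAdaptedFrame (h : IsReduced f N u v r t c) :
    ∀ q ∈ N, IsAdaptedFrame (f q) (push f q (u q)) (push f q (v q)) :=
  fun _ hq => (h.hasComponents hq).isUnitaryPair.isAdaptedFrame

theorem fsMetric_eq_zero (h : IsReduced f N u v r t c) :
    ∀ q ∈ N, fsMetric (f q) (push f q (u q)) (push f q (v q)) = 0 :=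
  fun _ hq => (h.hasComponents hq).fsMetric_eq_zero

theorem smooth_ratio (h : IsReduced f N u v r t c) : SmoothMapOn N (fun q => t q / r q) :=
  h.smooth_t.div h.smooth_r fun q hq => (h.pos q hq).ne'

theorem smooth_norm_sq (h : IsReduced f N u v r t c) : SmoothMapOn N (fun q => ‖c q‖ ^ 2) :=
  h.isSmoothFrame.smooth_c.contDiff_comp (contDiff_id.norm_sq ℝ)

theorem hasNormalForm_type2 (h : IsReduced f N u v r t c) (nonneg : ∀ q ∈ N, 0 ≤ t q)
    (c_eq_zero : ∀ q ∈ N, c q = 0) : HasNormalForm f N := by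
  have smooth_angle : SmoothMapOn N (fun q => 2 * Real.arctan (t q / r q) - Real.pi / 2) :=
    ((SmoothMapOn.const 2).mul (h.smooth_ratio.contDiff_comp Real.contDiff_arctan)).sub (.const _)
  refine ⟨u, v, h.isSmoothFrame.smooth_left, h.isSmoothFrame.smooth_right, h.isAdaptedFrame,
    h.fsMetric_eq_zero, .inr (.inr ⟨_, smooth_angle, fun q hq => ?_⟩)⟩
  have components := h.hasComponents hq
  rw [c_eq_zero q hq] at components
  have sum : r q ^ 2 + t q ^ 2 = 1 := by simpa using components.sum_sq
  refine ⟨?_, components.type2 (h.pos q hq)⟩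
  rw [Real.cos_sub_pi_div_two, Real.sin_two_mul, sin_arctan_div (h.pos q hq) sum,
    cos_arctan_div (h.pos q hq) sum]
  exact mul_nonneg (mul_nonneg zero_le_two (nonneg q hq)) (h.pos q hq).le

theorem exists_eq_I_mul_norm (h : IsReduced f N u v r r c) (hc : ∀ q ∈ N, c q ≠ 0) :
    ∃ u v, IsReduced f N u v r r (fun q => Complex.I * ‖c q‖) := by
  let s : M → ℂ := fun q => -Complex.I * c q
  have smooth_s : SmoothMapOn N s := (SmoothMapOn.const _).mul h.isSmoothFrame.smooth_c
  have s_ne : ∀ q ∈ N, s q ≠ 0 := fun q hq =>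
    mul_ne_zero (neg_ne_zero.2 Complex.I_ne_zero) (hc q hq)
  have norm_s (q : M) : ‖s q‖ = ‖c q‖ := by rw [norm_mul, norm_neg, Complex.norm_I, one_mul]
  have star_s (q : M) : star (s q) = Complex.I * star (c q) := by
    rw [star_mul', star_neg, Complex.star_def, Complex.conj_I, neg_neg]
  have smooth_norm := smooth_s.norm s_ne
  have norm_ne : ∀ q ∈ N, ‖s q‖ ≠ 0 := fun q hq => norm_ne_zero_iff.2 (s_ne q hq)
  have rotated := (h.isSmoothFrame.rotate (smooth_s.re.div smooth_norm norm_ne)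
    (smooth_s.im.div smooth_norm norm_ne)
    fun q hq => re_div_norm_sq_add_im_div_norm_sq (s_ne q hq)).mul_star_phase smooth_s s_ne
  refine ⟨_, _, rotated.congr (fun q hq => ?_) (fun q hq => ?_) (fun q hq => ?_), h.pos⟩
  · rw [← mul_assoc, ← add_mul, re_div_norm_add_im_div_norm_mul_I,
      star_div_norm_mul_div_norm_mul (s_ne q hq)]
  · refine (star_div_norm_mul_div_norm_mul (s_ne q hq) _).symm.trans (congrArg _ ?_)
    rw [← re_div_norm_add_im_div_norm_mul_I]
    linear_combination ((s q).im / ‖s q‖ : ℝ) * r q * Complex.I_sq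
  · rw [star_s, norm_s, mul_div_assoc, mul_assoc, star_div_norm_mul_self (hc q hq)]

theorem hasNormalForm_type1 (h : IsReduced f N u v r r c) (norm_sq : ∀ q ∈ N, ‖c q‖ ^ 2 = 1 / 2) :
    HasNormalForm f N := by
  have norm_eq : ∀ q ∈ N, ‖c q‖ = 1 / √2 := fun q hq => by
    rw [← Real.sqrt_sq (norm_nonneg (c q)), norm_sq q hq, Real.sqrt_div zero_le_one, Real.sqrt_one]
  have c_ne : ∀ q ∈ N, c q ≠ 0 := fun q hq => norm_ne_zero_iff.1 <| by
    rw [norm_eq q hq]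
    positivity
  have r_eq : ∀ q ∈ N, r q = 1 / 2 := fun q hq => by
    have sum := (h.hasComponents hq).sum_sq
    rw [norm_sq q hq] at sum
    nlinarith [h.pos q hq]
  obtain ⟨u', v', h'⟩ := h.exists_eq_I_mul_norm c_ne
  refine ⟨u', v', h'.isSmoothFrame.smooth_left, h'.isSmoothFrame.smooth_right, h'.isAdaptedFrame,
    h'.fsMetric_eq_zero, .inr (.inl fun q hq => HasComponents.type1 ?_)⟩
  simpa only [r_eq q hq, norm_eq q hq] using h'.hasComponents hq

theorem exists_hasNormalForm_type0 (h : IsReduced f N u v r t c) (nonempty : N.Nonempty)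
    (nonneg : ∀ q ∈ N, 0 ≤ t q) (c_ne : ∀ q ∈ N, c q ≠ 0)
    (exclusion : ∀ q ∈ N, ¬ (t q ^ 2 = r q ^ 2 ∧ ‖c q‖ ^ 2 = 1 / 2)) :
    ∃ N' ⊆ N, IsOpen N' ∧ N'.Nonempty ∧ HasNormalForm f N' := by
  obtain ⟨q₁, hq₁⟩ := nonempty
  obtain ⟨N', hN', isOpen, mem, w, smooth_w, exp_w⟩ :=
    h.isSmoothFrame.smooth_c.star.neg.exists_local_log h.isSmoothFrame.isOpen hq₁
      (neg_ne_zero.2 (star_ne_zero.2 (c_ne q₁ hq₁)))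
  have h' := h.mono isOpen hN'
  have smooth_angle : SmoothMapOn N' (fun q => Real.arcsin (2 * ‖c q‖ ^ 2 - 1)) := by
    refine (((SmoothMapOn.const 2).mul h'.smooth_norm_sq).sub (.const 1)).contDiffAt_comp
      fun q hq => Real.contDiffAt_arcsin ?_ ?_
    all_goals
      have norm_pos := norm_pos_iff.2 (c_ne q (hN' hq))
      have sum := (h'.hasComponents hq).sum_sq
      have r_pos := h'.pos q hq
      nlinarith
  refine ⟨N', hN', isOpen, ⟨q₁, mem⟩, u, v, h'.isSmoothFrame.smooth_left,
    h'.isSmoothFrame.smooth_right, h'.isAdaptedFrame, h'.fsMetric_eq_zero,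
    .inl ⟨_, _, _, h'.smooth_ratio, smooth_angle, smooth_w.im, fun q hq =>
      ⟨div_nonneg (nonneg q (hN' hq)) (h'.pos q hq).le, ?_⟩⟩⟩
  obtain ⟨cos_eq, sin_eq⟩ := norm_mul_cos_and_sin_of_exp_eq (exp_w q hq)
  exact (h'.hasComponents hq).type0 (h'.pos q hq) (c_ne q (hN' hq)) (exclusion q (hN' hq))
    cos_eq sin_eq

theorem isOpen_not_type1 (h : IsReduced f N u v r t c) :
    IsOpen {q ∈ N | ¬ (t q ^ 2 = r q ^ 2 ∧ ‖c q‖ ^ 2 = 1 / 2)} := by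
  have smooth : SmoothMapOn N (fun q => (t q * t q - r q * r q, ‖c q‖ ^ 2)) :=
    ((h.smooth_t.mul h.smooth_t).sub (h.smooth_r.mul h.smooth_r)).prodMk h.smooth_norm_sq
  convert smooth.isOpen_inter_preimage h.isSmoothFrame.isOpen
    (isOpen_compl_singleton (x := ((0 : ℝ), (1 / 2 : ℝ)))) using 1
  ext q
  simp [sub_eq_zero, sq]

end IsReduced

theorem exists_hasNormalForm (hf : IsTotallyReal f) {O : Set M} (isOpen : IsOpen O)
    (nonempty : O.Nonempty) : ∃ N ⊆ O, IsOpen N ∧ N.Nonempty ∧ HasNormalForm f N := by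
  obtain ⟨N, hN, nonempty, u, v, r, t, c, h, nonneg⟩ := exists_isReduced hf isOpen nonempty
  by_cases c_eq_zero : ∀ q ∈ N, c q = 0
  · exact ⟨N, hN, h.isSmoothFrame.isOpen, nonempty, h.hasNormalForm_type2 nonneg c_eq_zero⟩
  push Not at c_eq_zero
  obtain ⟨q₁, hq₁, c_ne⟩ := c_eq_zero
  let N₁ := N ∩ c ⁻¹' {0}ᶜ
  have isOpen₁ : IsOpen N₁ :=
    h.isSmoothFrame.smooth_c.isOpen_inter_preimage h.isSmoothFrame.isOpen isOpen_compl_singleton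
  have h₁ : IsReduced f N₁ u v r t c := h.mono isOpen₁ Set.inter_subset_left
  by_cases balanced : ∀ q ∈ N₁, t q ^ 2 = r q ^ 2 ∧ ‖c q‖ ^ 2 = 1 / 2
  · have t_eq : ∀ q ∈ N₁, t q = r q := fun q hq =>
      (pow_left_inj₀ (nonneg q hq.1) (h.pos q hq.1).le two_ne_zero).1 (balanced q hq).1
    have h₂ : IsReduced f N₁ u v r r c := ⟨h₁.isSmoothFrame.congr (fun _ _ => rfl)
      (fun q hq => by rw [t_eq q hq]) fun _ _ => rfl, h₁.pos⟩
    exact ⟨N₁, Set.inter_subset_left.trans hN, isOpen₁, ⟨q₁, hq₁, c_ne⟩,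
      h₂.hasNormalForm_type1 fun q hq => (balanced q hq).2⟩
  · have exists_ne : ∃ q ∈ N₁, ¬ (t q ^ 2 = r q ^ 2 ∧ ‖c q‖ ^ 2 = 1 / 2) := by
      simpa only [not_forall, exists_prop] using balanced
    obtain ⟨N', hN', isOpen', nonempty', normalForm⟩ :=
      (h₁.mono h₁.isOpen_not_type1 (Set.sep_subset _ _)).exists_hasNormalForm_type0 exists_ne
        (fun q hq => nonneg q hq.1.1) (fun q hq => hq.1.2) fun q hq => hq.2
    exact ⟨N', fun q hq => hN (hN' hq).1.1, isOpen', nonempty', normalForm⟩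

end NormalForm

end
end CP3

theorem mainTheorem8 {M : Type*} [TopologicalSpace M] [ChartedSpace CP3.E2 M]
    [IsManifold 𝓘(ℝ, CP3.E2) ∞ M] (f : M → CP3) (hf : CP3.IsTotallyReal f) :
    (∃ W : Set M, IsOpen W ∧ Dense W ∧ ∀ q₀ ∈ W, ∃ N ⊆ W, IsOpen N ∧ q₀ ∈ N ∧
      ∃ u v : ∀ q : M, TangentSpace 𝓘(ℝ, CP3.E2) q,
        CP3.SmoothFieldOn N u ∧ CP3.SmoothFieldOn N v ∧
        (∀ q ∈ N, CP3.IsAdaptedFrame (f q) (CP3.push f q (u q)) (CP3.push f q (v q))) ∧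
        (∀ q ∈ N, CP3.fsMetric (f q) (CP3.push f q (u q)) (CP3.push f q (v q)) = 0) ∧
        ((∃ l α θ : M → ℝ, CP3.SmoothFunOn N l ∧ CP3.SmoothFunOn N α ∧ CP3.SmoothFunOn N θ ∧
            ∀ q ∈ N, 0 ≤ l q ∧ CP3.Type0 (f q) (CP3.push f q (u q)) (CP3.push f q (v q)) (l q) (α q) (θ q)) ∨
          (∀ q ∈ N, CP3.Type1 (f q) (CP3.push f q (u q)) (CP3.push f q (v q))) ∨
          (∃ α : M → ℝ, CP3.SmoothFunOn N α ∧
            ∀ q ∈ N, 0 ≤ Real.cos (α q) ∧ CP3.Type2 (f q) (CP3.push f q (u q)) (CP3.push f q (v q)) (α q)))) ∧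
    ∀ q : M, ¬ (CP3.IsType0At f q ∧ CP3.IsType1At f q) ∧ ¬ (CP3.IsType0At f q ∧ CP3.IsType2At f q) ∧
      ¬ (CP3.IsType1At f q ∧ CP3.IsType2At f q) := by
  refine ⟨⟨⋃₀ {N | IsOpen N ∧ CP3.HasNormalForm f N}, isOpen_sUnion fun N hN => hN.1,
    dense_iff_inter_open.2 fun O isOpen nonempty => ?_, ?_⟩, fun q =>
    ⟨CP3.not_isType0At_and_isType1At hf, CP3.not_isType0At_and_isType2At hf,
      CP3.not_isType1At_and_isType2At hf⟩⟩
  · obtain ⟨N, subset, isOpen, ⟨q, hq⟩, normalForm⟩ :=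
      CP3.exists_hasNormalForm hf isOpen nonempty
    exact ⟨q, subset hq, N, ⟨isOpen, normalForm⟩, hq⟩
  · rintro q₀ ⟨N, ⟨isOpen, normalForm⟩, hq₀⟩
    exact ⟨N, Set.subset_sUnion_of_mem ⟨isOpen, normalForm⟩, isOpen, hq₀, normalForm⟩
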